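/- Let $n\ge 1$. For $t>0$ and $x,y\in\mathbb R^n$ let $$P_t(x,y)=\frac1{2\pi^{(n+1)/2}}\int_0^\infty \frac{t}{s^{3/2}}\,e^{-\frac{t^2}{4s}}\,\frac{e^{-\frac{|y-e^{-s}x|^2}{1-e^{-2s}}}}{(1-e^{-2s})^{n/2}}\,ds$$ be the Ornstein–Uhlenbeck Poisson kernel (the integral converges). There are constants $c,C>0$ depending only on $n$ such that for all $t>0$, all $x=(x_1,0,\dots,0)\in\mathbb R^n$ with $x_1\ge 0$ and all $y=(y_1,y')\in\mathbb R\times\mathbb R^{n-1}$, the partial derivative $\partial_{x_1}P_t(x,y)$ with respect to the first coordinate of $x$ exists and $$|\partial_{x_1}P_t(x,y)|\le C\,[Z_1(t,x,y)+Z_2(t,x,y)+Z_3(t,x,y)+Z_4(t,x,y)],$$ where, writing $\exp^*(-X)=\exp(-cX)$, $$Z_1=\frac{t}{(t^2+|x-y|^2)^{(n+2)/2}}\exp^*\!\big(-t(1+|x|)\big),$$ $$Z_2=\frac{t}{x_1^2}\Big(t^2+\frac{x_1-y_1}{x_1}+|y'|^2\Big)^{-\frac{n+4}2}\exp^*\!\Big(-\frac{(t^2+|y'|^2)x_1}{x_1-y_1}\Big)\quad\text{if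 } x_1>1 \text{ and } \tfrac{x_1}2\le y_1<x_1,\qquad Z_2=0\text{ otherwise},$$ $$Z_3=\frac{\min\{t,t^{-2}\}}{1+|x|}\exp^*(-|y|^2),$$ $$Z_4=\frac{t}{x_1y_1}\Big(\log\frac{x_1}{y_1}\Big)^{-\frac52}\exp^*\!\Big(-\frac{t^2}{\log\frac{x_1}{y_1}}\Big)\exp^*(-|y'|^2)\quad\text{if } 1<y_1<\tfrac{x_1}2,\qquad Z_4=0\text{ otherwise}.$$ Moreover, for all such $t$ and $x$, the function $y\mapsto\partial_{x_1}P_t(x,y)$ is integrable on $\mathbb R^n$ and $$\int_{\mathbb R^n}|\partial_{x_1}P_t(x,y)|\,dy\le C\,t^{-2}(1+x_1)^{-1}.$$ -/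

import Mathlib

namespace OUPoisson

open Real MeasureTheory

noncomputable section

/-- The Mehler kernel `M_r(x, y)` on `ℝⁿ`, for `0 < r < 1`. -/
def mehlerKernel {n : ℕ} (r : ℝ) (x y : EuclideanSpace ℝ (Fin n)) : ℝ :=
  exp (-(‖y - r • x‖ ^ 2 / (1 - r ^ 2))) / (1 - r ^ 2) ^ ((n : ℝ) / 2)

/-- The integrand (in the variable `s > 0`) of the subordination formula for the
Ornstein-Uhlenbeck Poisson kernel. -/
def poissonIntegrand {n : ℕ} (t : ℝ) (x y : EuclideanSpace ℝ (Fin n)) (s : ℝ) : ℝ :=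
  t / s ^ (3 / 2 : ℝ) * exp (-(t ^ 2 / (4 * s))) * mehlerKernel (exp (-s)) x y

/-- The Ornstein-Uhlenbeck Poisson kernel `P_t(x, y)` (with respect to Lebesgue measure in `y`). -/
def poissonKernel {n : ℕ} (t : ℝ) (x y : EuclideanSpace ℝ (Fin n)) : ℝ :=
  1 / (2 * π ^ (((n : ℝ) + 1) / 2)) * ∫ s in Set.Ioi (0 : ℝ), poissonIntegrand t x y s

/-- The first vector `e₁` of the standard basis; coordinates are numbered from `0`. -/
def e₁ (n : ℕ) [NeZero n] : EuclideanSpace ℝ (Fin n) := EuclideanSpace.single 0 1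

/-- The partial derivative `∂_{x₁} P_t(x, y)` in the first coordinate of `x`. -/
def dx₁PoissonKernel {n : ℕ} [NeZero n] (t : ℝ) (x y : EuclideanSpace ℝ (Fin n)) : ℝ :=
  lineDeriv ℝ (fun z => poissonKernel t z y) x (e₁ n)

/-- `|y'|²`, where `y = (y₁, y') ∈ ℝ × ℝⁿ⁻¹`. -/
def perpSq {n : ℕ} [NeZero n] (y : EuclideanSpace ℝ (Fin n)) : ℝ :=
  ∑ i ∈ Finset.univ.erase (0 : Fin n), y i ^ 2

/-! In the four kernels below, `exp*(-X)` is `exp (-(c * X))`. -/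

def Z₁ {n : ℕ} (c t : ℝ) (x y : EuclideanSpace ℝ (Fin n)) : ℝ :=
  t / (t ^ 2 + ‖x - y‖ ^ 2) ^ (((n : ℝ) + 2) / 2) * exp (-(c * (t * (1 + ‖x‖))))

def Z₂ {n : ℕ} [NeZero n] (c t : ℝ) (x y : EuclideanSpace ℝ (Fin n)) : ℝ :=
  if 1 < x 0 ∧ x 0 / 2 ≤ y 0 ∧ y 0 < x 0 then
    t / x 0 ^ 2 * (t ^ 2 + (x 0 - y 0) / x 0 + perpSq y) ^ (-(((n : ℝ) + 4) / 2)) *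
      exp (-(c * ((t ^ 2 + perpSq y) * x 0 / (x 0 - y 0))))
  else 0

def Z₃ {n : ℕ} (c t : ℝ) (x y : EuclideanSpace ℝ (Fin n)) : ℝ :=
  min t ((t ^ 2)⁻¹) / (1 + ‖x‖) * exp (-(c * ‖y‖ ^ 2))

def Z₄ {n : ℕ} [NeZero n] (c t : ℝ) (x y : EuclideanSpace ℝ (Fin n)) : ℝ :=
  if 1 < y 0 ∧ y 0 < x 0 / 2 then
    t / (x 0 * y 0) * log (x 0 / y 0) ^ (-(5 / 2) : ℝ) *
      exp (-(c * (t ^ 2 / log (x 0 / y 0)))) * exp (-(c * perpSq y))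
  else 0

end

end OUPoisson

namespace OUPoisson

open Real MeasureTheory Set Filter Topology

/-! ### One-dimensional integrals -/

/-! Put r = e^{-s}, m = 1 - r², a = y₁, x = x₁, p = |y'|². Differentiating under the integral sign
brings down the factor 2r(a - rx)/m. This factor changes sign at rx = a, where the Gaussian peaks,
so taking absolute values loses too much when a lies well below x.

The remedy is the identity ∂ₛ[(a - rx)²/m] = 2r(a - rx)(x - ra)/m². With φ = (a - rx)²/m it gives
2r(a - rx)/m · e^{-φ} = -m/(x - ra) · ∂ₛ e^{-φ}, and for a < x and x ≥ 1 one can integrate by parts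
in s (`integral_dxIntegrand_eq_integral_partsIntegrand`). The new integrand is at most a constant
times the envelope divided by (x - ra)(1 + s) (`abs_partsIntegrand_le`): polynomial factors cost
only half of the exponent.

Each integrand is then dominated by four majorants, one for each regime of s. Small s, where the
exponent controls |x - y|²/s + s x², gives Z₁. Values of s bounded below, with Gaussian decay in y,
give Z₃. When rx is close to a, s is comparable to u = (x - a)/x if a ≥ x/2 and to log(x/a) if 1 < a
< x/2; there the substitution w = x e^{-s} turns the remaining integral into a Gaussian one, giving
Z₂ and Z₄. If x ≤ 1, or if a ≥ x/2 and x(x - a) ≤ 1, the original integrand already obeys the Z₁ and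
Z₃ bounds.

For the L¹ bound, y' is integrated out as a Gaussian (`integrable_mul_exp_neg_perpSq`). Z₂ and Z₄
then both reduce to t/x · ∫ s^{-5/2} e^{-ct²/s} ds, a multiple of t⁻²/x; Z₁ and Z₃ follow by scaling
and by min{t, t⁻²} ≤ t⁻². -/

lemma rpow_mul_exp_neg_div_substitution {b A s : ℝ} (hs : 0 < s) :
    (|(-1 : ℝ)| * s ^ ((-1 : ℝ) - 1)) • ((s ^ (-1 : ℝ)) ^ (b - 1) * exp (-(A * s ^ (-1 : ℝ)))) =
      s ^ (-(b + 1)) * exp (-(A / s)) := by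
  rw [← rpow_mul hs.le, smul_eq_mul, ← mul_assoc, abs_neg, abs_one, one_mul, ← rpow_add hs,
    rpow_neg_one, div_eq_mul_inv]
  congr 2
  ring

lemma integrableOn_rpow_mul_exp_neg_div {b A : ℝ} (hb : 0 < b) (hA : 0 < A) :
    IntegrableOn (fun s : ℝ => s ^ (-(b + 1)) * exp (-(A / s))) (Ioi 0) := by
  have h : IntegrableOn (fun y : ℝ => y ^ (b - 1) * exp (-(A * y))) (Ioi 0) := by
    have := integrableOn_rpow_mul_exp_neg_mul_rpow (p := 1) (s := b - 1) (b := A)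
      (by linarith) one_pos hA
    simpa using this
  refine ((integrableOn_Ioi_comp_rpow_iff _ (by norm_num : (-1 : ℝ) ≠ 0)).2 h).congr_fun
    (fun s hs => ?_) measurableSet_Ioi
  exact rpow_mul_exp_neg_div_substitution hs

/-- The substitution s ↦ s⁻¹ turns this into the Gamma integral. All integrals of the majorants for
Z₁ and Z₃, and the last step for Z₂ and Z₄, come down to it. -/
lemma integral_rpow_mul_exp_neg_div {b A : ℝ} (hb : 0 < b) (hA : 0 < A) :
    ∫ s in Ioi (0 : ℝ), s ^ (-(b + 1)) * exp (-(A / s)) = Gamma b * A ^ (-b) := by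
  have h := integral_rpow_mul_exp_neg_mul_Ioi hb hA
  rw [← integral_comp_rpow_Ioi (fun y : ℝ => y ^ (b - 1) * exp (-(A * y)))
    (by norm_num : (-1 : ℝ) ≠ 0)] at h
  rw [rpow_neg hA.le, ← inv_rpow hA.le, ← one_div, mul_comm, ← h]
  exact setIntegral_congr_fun measurableSet_Ioi
    fun s hs => (rpow_mul_exp_neg_div_substitution hs).symm

lemma image_mul_exp_neg_Ioi {x : ℝ} (hx : 0 < x) :
    (fun s : ℝ => x * exp (-s)) '' Ioi 0 = Ioo 0 x := by
  ext w
  constructor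
  · rintro ⟨s, hs, rfl⟩
    refine ⟨by positivity, ?_⟩
    have : exp (-s) < 1 := by simpa using hs
    nlinarith
  · rintro ⟨h0, h1⟩
    refine ⟨log (x / w), log_pos ((one_lt_div h0).2 h1), ?_⟩
    simp only
    rw [← log_inv, exp_log (by positivity)]
    field_simp

lemma hasDerivWithinAt_mul_exp_neg (x s : ℝ) (S : Set ℝ) :
    HasDerivWithinAt (fun s : ℝ => x * exp (-s)) (-(x * exp (-s))) S s := by
  have h := (((hasDerivAt_id s).neg).exp).const_mul x
  refine (h.congr_deriv ?_).hasDerivWithinAt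
  simp

lemma injOn_mul_exp_neg {x : ℝ} (hx : 0 < x) (S : Set ℝ) :
    InjOn (fun s : ℝ => x * exp (-s)) S := by
  intro a _ b _ h
  simpa [hx.ne'] using h

lemma abs_neg_mul_exp_neg {x : ℝ} (hx : 0 < x) (s : ℝ) :
    |(-(x * exp (-s)))| = x * exp (-s) := by
  rw [abs_neg, abs_of_pos (by positivity)]

/-- Change of variables w = x e^{-s}. It is used both to integrate the majorants near rx = a and to
integrate Z₄ in y₁. -/
lemma integral_mul_exp_neg_comp {x : ℝ} (hx : 0 < x) (g : ℝ → ℝ) :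
    ∫ s in Ioi (0 : ℝ), x * exp (-s) * g (x * exp (-s)) = ∫ w in Ioo 0 x, g w := by
  rw [← image_mul_exp_neg_Ioi hx, integral_image_eq_integral_abs_deriv_smul measurableSet_Ioi
    (fun s _ => hasDerivWithinAt_mul_exp_neg x s _) (injOn_mul_exp_neg hx _)]
  simp_rw [abs_neg_mul_exp_neg hx, smul_eq_mul]

lemma integrableOn_mul_exp_neg_comp {x : ℝ} (hx : 0 < x) (g : ℝ → ℝ) :
    IntegrableOn (fun s : ℝ => x * exp (-s) * g (x * exp (-s))) (Ioi 0) ↔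
      IntegrableOn g (Ioo 0 x) := by
  rw [← image_mul_exp_neg_Ioi hx, integrableOn_image_iff_integrableOn_abs_deriv_smul
    measurableSet_Ioi (fun s _ => hasDerivWithinAt_mul_exp_neg x s _) (injOn_mul_exp_neg hx _)]
  simp_rw [abs_neg_mul_exp_neg hx, smul_eq_mul]

lemma integrable_gaussian_sub {b : ℝ} (hb : 0 < b) (a : ℝ) :
    Integrable fun w : ℝ => exp (-(b * (w - a) ^ 2)) := by
  have := (integrable_exp_neg_mul_sq hb).comp_sub_right a
  simpa [neg_mul] using this

lemma integral_gaussian_sub (b a : ℝ) :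
    ∫ w : ℝ, exp (-(b * (w - a) ^ 2)) = √(π / b) := by
  rw [integral_sub_right_eq_self (fun w : ℝ => exp (-(b * w ^ 2))) a, ← integral_gaussian b]
  simp [neg_mul]

lemma integrableOn_exp_neg_mul_gaussian {x b : ℝ} (hx : 0 < x) (hb : 0 < b) (a : ℝ) :
    IntegrableOn (fun s : ℝ => x * exp (-s) * exp (-(b * (x * exp (-s) - a) ^ 2))) (Ioi 0) :=
  (integrableOn_mul_exp_neg_comp hx fun w => exp (-(b * (w - a) ^ 2))).2
    (integrable_gaussian_sub hb a).integrableOn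

lemma integral_exp_neg_mul_gaussian_le {x b : ℝ} (hx : 0 < x) (hb : 0 < b) (a : ℝ) :
    ∫ s in Ioi (0 : ℝ), x * exp (-s) * exp (-(b * (x * exp (-s) - a) ^ 2)) ≤ √(π / b) := by
  rw [integral_mul_exp_neg_comp hx fun w => exp (-(b * (w - a) ^ 2)), ← integral_gaussian_sub b a]
  exact setIntegral_le_integral (integrable_gaussian_sub hb a)
    (ae_of_all _ fun w => (exp_pos _).le)

/-! ### Elementary inequalities -/

lemma one_sub_exp_neg_sq_pos {s : ℝ} (hs : 0 < s) : 0 < 1 - exp (-s) ^ 2 := by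
  have h1 : exp (-s) < 1 := by simpa using hs
  nlinarith [exp_pos (-s)]

lemma one_sub_exp_neg_sq_le_one (s : ℝ) : 1 - exp (-s) ^ 2 ≤ 1 := by
  nlinarith [sq_nonneg (exp (-s))]

lemma exp_neg_mul_one_add_le_one {s : ℝ} (hs : 0 ≤ s) : exp (-s) * (1 + s) ≤ 1 := by
  have h := add_one_le_exp s
  have h2 : exp (-s) * exp s = 1 := by rw [← exp_add]; simp
  nlinarith [exp_pos (-s)]

lemma one_sub_exp_neg_sq_le {s : ℝ} : 1 - exp (-s) ^ 2 ≤ 2 * s := by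
  have h := add_one_le_exp (-(2 * s))
  have h2 : exp (-s) ^ 2 = exp (-(2 * s)) := by rw [← exp_nat_mul]; congr 1; push_cast; ring
  rw [h2]; linarith

lemma two_mul_le_one_sub_exp_neg_sq {s : ℝ} (hs : 0 < s) :
    2 * s ≤ (1 - exp (-s) ^ 2) * (1 + 2 * s) := by
  have h := exp_neg_mul_one_add_le_one (s := 2 * s) (by linarith)
  have h2 : exp (-s) ^ 2 = exp (-(2 * s)) := by rw [← exp_nat_mul]; congr 1; push_cast; ring
  rw [h2]; linarith

lemma inv_one_sub_exp_neg_sq_le {s : ℝ} (hs : 0 < s) :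
    (1 - exp (-s) ^ 2)⁻¹ ≤ 1 + (2 * s)⁻¹ := by
  have hm := one_sub_exp_neg_sq_pos hs
  have h := two_mul_le_one_sub_exp_neg_sq hs
  rw [inv_le_iff_one_le_mul₀ hm]
  have : (1 + (2 * s)⁻¹) * (1 - exp (-s) ^ 2) = (1 - exp (-s) ^ 2) * (1 + 2 * s) / (2 * s) := by
    field_simp; ring
  rw [this, le_div_iff₀ (by positivity)]
  linarith

/-- Powers of `1 - e^{-2s}` for bounded `s`. -/
lemma one_sub_exp_neg_sq_rpow_le_of_le_two {s b : ℝ} (hs : 0 < s) (hs2 : s ≤ 2) (hb : 0 ≤ b) :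
    (1 - exp (-s) ^ 2) ^ (-b) ≤ (5 / 2) ^ b * s ^ (-b) := by
  have hm := one_sub_exp_neg_sq_pos hs
  rw [rpow_neg hm.le, ← inv_rpow hm.le, rpow_neg hs.le, ← inv_rpow hs.le,
    ← mul_rpow (by norm_num) (by positivity)]
  refine rpow_le_rpow (by positivity) ((inv_one_sub_exp_neg_sq_le hs).trans ?_) hb
  rw [← sub_nonneg]
  have : 5 / 2 * s⁻¹ - (1 + (2 * s)⁻¹) = (2 - s) / s := by field_simp; ring
  rw [this]
  exact div_nonneg (by linarith) hs.le

/-- Powers of `1 - e^{-2s}` for `s` away from `0`. -/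
lemma one_sub_exp_neg_sq_rpow_le_of_le {s b : ℝ} (hs : 1 / 5 ≤ s) (hb : 0 ≤ b) :
    (1 - exp (-s) ^ 2) ^ (-b) ≤ (7 / 2) ^ b := by
  have hs0 : 0 < s := by linarith
  have hm := one_sub_exp_neg_sq_pos hs0
  rw [rpow_neg hm.le, ← inv_rpow hm.le]
  refine rpow_le_rpow (by positivity) ((inv_one_sub_exp_neg_sq_le hs0).trans ?_) hb
  have : (2 * s)⁻¹ ≤ (2 / 5)⁻¹ := inv_anti₀ (by norm_num) (by linarith)
  linarith [show ((2 : ℝ) / 5)⁻¹ = 5 / 2 by norm_num]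

lemma one_sub_exp_neg_sq_rpow_le {s b : ℝ} (hs : 0 < s) (hb : 0 ≤ b) :
    (1 - exp (-s) ^ 2) ^ (-b) ≤ (7 / 2) ^ b + (5 / 2) ^ b * s ^ (-b) := by
  rcases le_total s 2 with h | h
  · exact (one_sub_exp_neg_sq_rpow_le_of_le_two hs h hb).trans
      (le_add_of_nonneg_left (by positivity))
  · exact (one_sub_exp_neg_sq_rpow_le_of_le (by linarith) hb).trans
      (le_add_of_nonneg_right (by positivity))

/-- Exponentials dominate powers. -/
lemma one_add_rpow_le_exp {b δ A : ℝ} (hb : 0 < b) (hδ : 0 < δ) (hA : 0 ≤ A) :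
    (1 + A) ^ b ≤ (b / δ) ^ b * exp δ * exp (δ * A) := by
  have h1 : δ * (1 + A) / b ≤ exp (δ * (1 + A) / b) := by
    linarith [add_one_le_exp (δ * (1 + A) / b)]
  have h2 := rpow_le_rpow (by positivity) h1 hb.le
  rw [← exp_mul, div_mul_cancel₀ _ hb.ne'] at h2
  have h3 : (1 + A) ^ b = (b / δ) ^ b * (δ * (1 + A) / b) ^ b := by
    rw [← mul_rpow (by positivity) (by positivity)]
    congr 1
    field_simp
  rw [h3, mul_assoc, ← exp_add]
  refine mul_le_mul_of_nonneg_left (h2.trans_eq ?_) (by positivity)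
  congr 1
  ring

/-- Half of a Gaussian in z/√m pays for one factor z, at the price √m. -/
lemma abs_le_sqrt_mul_exp {z m : ℝ} (hm : 0 < m) :
    |z| ≤ √m * exp (z ^ 2 / m / 2) := by
  have h1 := add_one_le_exp (z ^ 2 / m)
  rw [← sqrt_sq_eq_abs]
  have h2 : exp (z ^ 2 / m / 2) = √(exp (z ^ 2 / m)) := by rw [exp_half]
  rw [h2, ← sqrt_mul hm.le]
  refine sqrt_le_sqrt ?_
  have : z ^ 2 = m * (z ^ 2 / m) := by field_simp
  nlinarith

/-! ### The derivative of the integrand and its integration by parts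

Throughout, `ν = n / 2`, `a = y₁`, `p = |y'|²` and `x = x₁`. -/

noncomputable section

/-- The integrand of `∂_{x₁} P_t(x, y)`. -/
def dxIntegrand (ν t p a x s : ℝ) : ℝ :=
  t / s ^ (3 / 2 : ℝ) * exp (-(t ^ 2 / (4 * s))) *
    (exp (-(((a - exp (-s) * x) ^ 2 + p) / (1 - exp (-s) ^ 2))) / (1 - exp (-s) ^ 2) ^ ν) *
      (2 * exp (-s) * (a - exp (-s) * x) / (1 - exp (-s) ^ 2))

/-- Half of the exponent in `dxIntegrand`. -/
def halfExponent (t p a x s : ℝ) : ℝ :=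
  t ^ 2 / (8 * s) + ((a - exp (-s) * x) ^ 2 + p) / (2 * (1 - exp (-s) ^ 2))

/-- The common factor in the estimates of the integrands. -/
def envelope (ν t p a x s : ℝ) : ℝ :=
  t * s ^ (-(3 / 2) : ℝ) * (1 - exp (-s) ^ 2) ^ (-ν) * exp (-halfExponent t p a x s)

/-- The boundary term of the integration by parts. -/
def boundaryTerm (ν t p a x s : ℝ) : ℝ :=
  t * s ^ (-(3 / 2) : ℝ) * (1 - exp (-s) ^ 2) ^ (1 - ν) *
    exp (-(t ^ 2 / (4 * s)) - ((a - exp (-s) * x) ^ 2 + p) / (1 - exp (-s) ^ 2)) /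
      (x - exp (-s) * a)

/-- The integrand after the integration by parts. -/
def partsIntegrand (ν t p a x s : ℝ) : ℝ :=
  boundaryTerm ν t p a x s *
    (-3 / (2 * s) + t ^ 2 / (4 * s ^ 2) + (1 - ν) * (2 * exp (-s) ^ 2) / (1 - exp (-s) ^ 2) +
      p * (2 * exp (-s) ^ 2) / (1 - exp (-s) ^ 2) ^ 2 - exp (-s) * a / (x - exp (-s) * a))

end

lemma dxIntegrand_eq {ν t p a x s : ℝ} (hs : 0 < s) :
    dxIntegrand ν t p a x s = t * s ^ (-(3 / 2) : ℝ) * (1 - exp (-s) ^ 2) ^ (-ν) *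
      exp (-(t ^ 2 / (4 * s)) - ((a - exp (-s) * x) ^ 2 + p) / (1 - exp (-s) ^ 2)) *
        (2 * exp (-s) * (a - exp (-s) * x) / (1 - exp (-s) ^ 2)) := by
  rw [dxIntegrand, rpow_neg hs.le, rpow_neg (one_sub_exp_neg_sq_pos hs).le, sub_eq_add_neg
    (-(t ^ 2 / (4 * s))), exp_add]
  simp only [div_eq_mul_inv]
  ring

/-- Differentiating the Gaussian in a - rx reproduces minus the original integrand, by ∂ₛ[(a -
rx)²/m] = 2r(a - rx)(x - ra)/m². The other factors contribute the five terms of the bracket in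
`partsIntegrand`. -/
lemma hasDerivAt_boundaryTerm {ν t p a x s : ℝ} (hs : 0 < s) (hx : 0 < x - exp (-s) * a) :
    HasDerivAt (boundaryTerm ν t p a x)
      (partsIntegrand ν t p a x s - dxIntegrand ν t p a x s) s := by
  have hm := one_sub_exp_neg_sq_pos hs
  have hr : HasDerivAt (fun s : ℝ => exp (-s)) (-exp (-s)) s := by
    simpa using ((hasDerivAt_id s).neg).exp
  have hm' : HasDerivAt (fun s : ℝ => 1 - exp (-s) ^ 2) (2 * exp (-s) ^ 2) s := by
    refine ((hr.pow 2).const_sub 1).congr_deriv ?_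
    simp; ring
  have h1 : HasDerivAt (fun s : ℝ => s ^ (-(3 / 2) : ℝ)) (-(3 / 2) * s ^ (-(3 / 2) : ℝ) / s) s := by
    refine ((hasDerivAt_id s).rpow_const (p := -(3 / 2)) (Or.inl hs.ne')).congr_deriv ?_
    simp only [id]
    rw [rpow_sub_one hs.ne']; ring
  have h2 : HasDerivAt (fun s : ℝ => (1 - exp (-s) ^ 2) ^ (1 - ν))
      (2 * exp (-s) ^ 2 * (1 - ν) * (1 - exp (-s) ^ 2) ^ (1 - ν) / (1 - exp (-s) ^ 2)) s := by
    refine (hm'.rpow_const (p := 1 - ν) (Or.inl hm.ne')).congr_deriv ?_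
    rw [rpow_sub_one hm.ne']; ring
  have h3 : HasDerivAt (fun s : ℝ => t ^ 2 / (4 * s)) (-(t ^ 2 / (4 * s ^ 2))) s := by
    refine (((hasDerivAt_id s).const_mul 4).fun_inv (by simp [hs.ne'])).const_mul (t ^ 2)
      |>.congr_deriv ?_
    simp only [id]
    field_simp
  have h4 : HasDerivAt (fun s : ℝ => ((a - exp (-s) * x) ^ 2 + p) / (1 - exp (-s) ^ 2))
      ((2 * (a - exp (-s) * x) * (exp (-s) * x) * (1 - exp (-s) ^ 2) -
        ((a - exp (-s) * x) ^ 2 + p) * (2 * exp (-s) ^ 2)) / (1 - exp (-s) ^ 2) ^ 2) s := by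
    refine (((((hr.mul_const x).const_sub a).pow 2).add_const p).fun_div hm' hm.ne').congr_deriv ?_
    simp
  have h5 : HasDerivAt (fun s : ℝ => x - exp (-s) * a) (exp (-s) * a) s := by
    refine ((hr.mul_const a).const_sub x).congr_deriv ?_
    ring
  have key := (((h1.const_mul t).mul h2).mul (h3.neg.sub h4).exp).fun_div h5 hx.ne'
  refine key.congr_deriv ?_
  rw [partsIntegrand, boundaryTerm, dxIntegrand_eq hs,
    show -ν = 1 - ν - 1 by ring, rpow_sub_one hm.ne']
  simp only [Pi.mul_apply, Pi.neg_apply, Pi.sub_apply]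
  generalize exp (-(t ^ 2 / (4 * s)) - ((a - exp (-s) * x) ^ 2 + p) / (1 - exp (-s) ^ 2)) = e
  generalize s ^ (-(3 / 2) : ℝ) = s'
  generalize hmm : (1 - exp (-s) ^ 2) = m at *
  generalize m ^ (1 - ν) = m'
  have hm2 : m = 1 - exp (-s) ^ 2 := hmm.symm
  generalize exp (-s) = r at *
  -- With x = q + ra and m = 1 - r², what is left is a rational identity in independent quantities.
  generalize hq : x - r * a = q at *
  have hx2 : x = q + r * a := by linarith
  field_simp
  rw [hx2, hm2]
  ring

lemma envelope_nonneg {ν t p a x s : ℝ} (ht : 0 < t) (hs : 0 < s) :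
    0 ≤ envelope ν t p a x s := by
  have := one_sub_exp_neg_sq_pos hs
  unfold envelope
  positivity

/-- Half of the exponent absorbs |a - rx|/√m, so of the factor 2r(a - rx)/m only 2r/√m survives. -/
lemma abs_dxIntegrand_le {ν t p a x s : ℝ} (ht : 0 < t) (hp : 0 ≤ p) (hs : 0 < s) :
    |dxIntegrand ν t p a x s| ≤
      2 * envelope ν t p a x s * exp (-s) * (1 - exp (-s) ^ 2) ^ (-(1 / 2) : ℝ) := by
  have hm := one_sub_exp_neg_sq_pos hs
  rw [dxIntegrand_eq hs, envelope, halfExponent]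
  have hz := abs_le_sqrt_mul_exp (z := a - exp (-s) * x) hm
  rw [rpow_neg hm.le (1 / 2), ← sqrt_eq_rpow, abs_mul,
    abs_of_nonneg (by positivity : 0 ≤ t * s ^ (-(3 / 2) : ℝ) * (1 - exp (-s) ^ 2) ^ (-ν) *
      exp (-(t ^ 2 / (4 * s)) - ((a - exp (-s) * x) ^ 2 + p) / (1 - exp (-s) ^ 2))),
    abs_div, abs_of_pos hm, abs_mul, abs_of_pos (by positivity : 0 < 2 * exp (-s))]
  have hexp : exp (-(t ^ 2 / (4 * s)) - ((a - exp (-s) * x) ^ 2 + p) / (1 - exp (-s) ^ 2)) *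
      exp ((a - exp (-s) * x) ^ 2 / (1 - exp (-s) ^ 2) / 2) ≤
      exp (-(t ^ 2 / (8 * s) + ((a - exp (-s) * x) ^ 2 + p) / (2 * (1 - exp (-s) ^ 2)))) := by
    rw [← exp_add, exp_le_exp]
    have h1 : 0 ≤ t ^ 2 / (8 * s) := by positivity
    have h2 : 0 ≤ p / (2 * (1 - exp (-s) ^ 2)) := by positivity
    have h3 : t ^ 2 / (4 * s) = 2 * (t ^ 2 / (8 * s)) := by field_simp; norm_num
    have h4 : p / (1 - exp (-s) ^ 2) = 2 * (p / (2 * (1 - exp (-s) ^ 2))) := by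
      field_simp
    have h5 : (a - exp (-s) * x) ^ 2 / (2 * (1 - exp (-s) ^ 2)) =
      (a - exp (-s) * x) ^ 2 / (1 - exp (-s) ^ 2) / 2 := by field_simp
    rw [add_div, add_div, h3, h4, h5]
    linarith
  have hsq : √(1 - exp (-s) ^ 2) / (1 - exp (-s) ^ 2) = (√(1 - exp (-s) ^ 2))⁻¹ := by
    rw [sqrt_div_self]
  calc _ ≤ t * s ^ (-(3 / 2) : ℝ) * (1 - exp (-s) ^ 2) ^ (-ν) *
        exp (-(t ^ 2 / (4 * s)) - ((a - exp (-s) * x) ^ 2 + p) / (1 - exp (-s) ^ 2)) *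
        (2 * exp (-s) * (√(1 - exp (-s) ^ 2) *
          exp ((a - exp (-s) * x) ^ 2 / (1 - exp (-s) ^ 2) / 2)) / (1 - exp (-s) ^ 2)) := by
        gcongr
    _ = 2 * (t * s ^ (-(3 / 2) : ℝ) * (1 - exp (-s) ^ 2) ^ (-ν) *
        (exp (-(t ^ 2 / (4 * s)) - ((a - exp (-s) * x) ^ 2 + p) / (1 - exp (-s) ^ 2)) *
          exp ((a - exp (-s) * x) ^ 2 / (1 - exp (-s) ^ 2) / 2))) * exp (-s) *
            (√(1 - exp (-s) ^ 2) / (1 - exp (-s) ^ 2)) := by ring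
    _ ≤ _ := by rw [hsq]; gcongr

lemma sub_exp_neg_mul_pos {a x s : ℝ} (hs : 0 < s) (hx : 1 ≤ x) (hax : a < x) :
    0 < x - exp (-s) * a := by
  have h1 : exp (-s) < 1 := by simpa using hs
  have h0 := exp_pos (-s)
  rcases le_total a 0 with h | h <;> nlinarith

/-- The logarithmic derivative of the denominator `x - e^{-s} a`. -/
lemma one_sub_exp_neg_sq_mul_abs_div_le {a x s : ℝ} (hs : 0 < s) (hx : 1 ≤ x) (hax : a < x) :
    (1 - exp (-s) ^ 2) * |exp (-s) * a / (x - exp (-s) * a)| ≤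
      (2 + (a - exp (-s) * x) ^ 2 / (1 - exp (-s) ^ 2)) / (1 + s) := by
  have hm := one_sub_exp_neg_sq_pos hs
  have hm1 := one_sub_exp_neg_sq_le_one s
  have hq := sub_exp_neg_mul_pos hs hx hax
  have hr1 : exp (-s) < 1 := by simpa using hs
  have hr0 := exp_pos (-s)
  have hrs := exp_neg_mul_one_add_le_one hs.le
  rw [abs_div, abs_of_pos hq, abs_mul, abs_of_pos hr0, ← mul_div_assoc, div_le_div_iff₀ hq
    (by linarith)]
  -- If |a| ≤ x, use m = (1 - r)(1 + r) and x - ra ≥ (1 - r)x. If a < -x, then |a - rx| ≥ |a|, and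
  -- the quadratic term on the right absorbs |a|.
  rcases le_or_gt (-x) a with h | h
  · have ha : |a| ≤ x := abs_le.2 ⟨h, hax.le⟩
    have h1 : (1 - exp (-s)) * x ≤ x - exp (-s) * a := by nlinarith
    have h2 : 0 ≤ (a - exp (-s) * x) ^ 2 / (1 - exp (-s) ^ 2) := by positivity
    calc (1 - exp (-s) ^ 2) * (exp (-s) * |a|) * (1 + s)
        ≤ (1 - exp (-s) ^ 2) * (exp (-s) * x) * (1 + s) := by gcongr
      _ = (1 + exp (-s)) * ((1 - exp (-s)) * x) * (exp (-s) * (1 + s)) := by ring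
      _ ≤ 2 * (x - exp (-s) * a) * 1 := by
          have : 0 ≤ (1 - exp (-s)) * x := mul_nonneg (by linarith) (by linarith)
          gcongr
          linarith
      _ ≤ _ := by nlinarith
  · have ha : |a| = -a := abs_of_neg (by linarith)
    have h2 : a ^ 2 ≤ (a - exp (-s) * x) ^ 2 / (1 - exp (-s) ^ 2) := by
      rw [le_div_iff₀ hm]
      nlinarith [sq_nonneg a, mul_pos hr0 (by linarith : 0 < x),
        mul_pos (mul_pos hr0 (by linarith : 0 < x)) (by linarith : 0 < -a)]
    have h3 : 1 ≤ x - exp (-s) * a := by nlinarith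
    have h4 : -a ≤ 2 + a ^ 2 := by nlinarith
    rw [ha]
    calc (1 - exp (-s) ^ 2) * (exp (-s) * -a) * (1 + s)
        = (1 - exp (-s) ^ 2) * (-a) * (exp (-s) * (1 + s)) := by ring
      _ ≤ 1 * (-a) * 1 := by
          have : 0 ≤ -a := by linarith
          gcongr
      _ ≤ (2 + (a - exp (-s) * x) ^ 2 / (1 - exp (-s) ^ 2)) * 1 := by linarith
      _ ≤ _ := by gcongr

/-- The full exponent is X + Y + Z, with X, Y, Z the parts coming from t, p and a - rx. Multiplied
by the factor m of the boundary term, the bracket grows at most linearly in X + Y + Z and decays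
like 1/(1 + s). One half of the exponent absorbs the linear growth, the other half is the envelope.
-/
lemma abs_partsIntegrand_le {ν t p a x s : ℝ} (ht : 0 < t) (hp : 0 ≤ p) (hs : 0 < s)
    (hx : 1 ≤ x) (hax : a < x) :
    |partsIntegrand ν t p a x s| ≤
      (7 + 2 * |1 - ν|) * envelope ν t p a x s / ((x - exp (-s) * a) * (1 + s)) := by
  have hm := one_sub_exp_neg_sq_pos hs
  have hm1 := one_sub_exp_neg_sq_le_one s
  have hm2 := one_sub_exp_neg_sq_le (s := s)
  have hq := sub_exp_neg_mul_pos hs hx hax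
  have hr0 := exp_pos (-s)
  have hrs := exp_neg_mul_one_add_le_one hs.le
  have hT := one_sub_exp_neg_sq_mul_abs_div_le hs hx hax
  have hr1 : exp (-s) < 1 := by simpa using hs
  set m := 1 - exp (-s) ^ 2 with hmdef
  set X := t ^ 2 / (4 * s) with hX
  set Y := p / m with hY
  set Z := (a - exp (-s) * x) ^ 2 / m with hZ
  have hX0 : 0 ≤ X := by positivity
  have hY0 : 0 ≤ Y := by positivity
  have hZ0 : 0 ≤ Z := by positivity
  -- From m ≤ 2s and m ≤ 1: m(1 + s) ≤ 2s + s.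
  have hms : m / s ≤ 3 / (1 + s) := by
    rw [div_le_div_iff₀ hs (by linarith)]
    nlinarith
  have hr2 : exp (-s) ^ 2 ≤ 1 / (1 + s) := by
    rw [le_div_iff₀ (by linarith)]
    nlinarith
  have hW : halfExponent t p a x s = (X + Y + Z) / 2 := by
    rw [halfExponent, hX, hY, hZ, ← hmdef]
    field_simp
    ring
  have hE : exp (-X - ((a - exp (-s) * x) ^ 2 + p) / m) = exp (-((X + Y + Z) / 2)) *
      exp (-((X + Y + Z) / 2)) := by
    rw [← exp_add]
    congr 1
    rw [hY, hZ, add_div]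
    ring
  have hexp : exp (-((X + Y + Z) / 2)) * (1 + (X + Y + Z) / 2) ≤ 1 :=
    exp_neg_mul_one_add_le_one (by positivity)
  have hbr : m * |(-3 / (2 * s) + t ^ 2 / (4 * s ^ 2) + (1 - ν) * (2 * exp (-s) ^ 2) / m +
      p * (2 * exp (-s) ^ 2) / m ^ 2 - exp (-s) * a / (x - exp (-s) * a))| ≤
      (7 + 2 * |1 - ν|) * (1 + (X + Y + Z) / 2) / (1 + s) := by
    have e1 : |(-3 / (2 * s))| = 3 / 2 * (1 / s) := by
      rw [abs_div, abs_neg, abs_of_pos (by norm_num : (0:ℝ) < 3), abs_of_pos (by positivity)]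
      field_simp
    have e2 : |t ^ 2 / (4 * s ^ 2)| = X * (1 / s) := by
      rw [abs_of_nonneg (by positivity), hX]
      field_simp
    have e3 : |(1 - ν) * (2 * exp (-s) ^ 2) / m| = 2 * |1 - ν| * exp (-s) ^ 2 / m := by
      rw [abs_div, abs_mul, abs_of_pos hm, abs_of_nonneg (by positivity : 0 ≤ 2 * exp (-s) ^ 2)]
      ring
    have e4 : |p * (2 * exp (-s) ^ 2) / m ^ 2| = 2 * Y * exp (-s) ^ 2 / m := by
      rw [abs_of_nonneg (by positivity), hY]
      field_simp
    calc _ ≤ m * (|(-3 / (2 * s))| + |t ^ 2 / (4 * s ^ 2)| + |(1 - ν) * (2 * exp (-s) ^ 2) / m| +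
          |p * (2 * exp (-s) ^ 2) / m ^ 2| + |exp (-s) * a / (x - exp (-s) * a)|) := by
          gcongr
          refine (abs_sub _ _).trans ?_
          gcongr
          refine (abs_add_le _ _).trans ?_
          gcongr
          refine (abs_add_le _ _).trans ?_
          gcongr
          exact abs_add_le _ _
      _ = (3 / 2 + X) * (m / s) + (2 * |1 - ν| + 2 * Y) * exp (-s) ^ 2 +
          m * |exp (-s) * a / (x - exp (-s) * a)| := by
          rw [e1, e2, e3, e4]
          field_simp
          ring
      _ ≤ (3 / 2 + X) * (3 / (1 + s)) + (2 * |1 - ν| + 2 * Y) * (1 / (1 + s)) +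
          (2 + Z) / (1 + s) := by gcongr
      _ = (9 / 2 + 3 * X + 2 * |1 - ν| + 2 * Y + 2 + Z) / (1 + s) := by
          field_simp; ring
      _ ≤ _ := by
          gcongr
          nlinarith [abs_nonneg (1 - ν), mul_nonneg (abs_nonneg (1 - ν)) hX0,
            mul_nonneg (abs_nonneg (1 - ν)) hY0, mul_nonneg (abs_nonneg (1 - ν)) hZ0]
  rw [partsIntegrand, boundaryTerm, envelope, hW, ← hmdef, hE, abs_mul, abs_of_nonneg
    (by positivity), show (1 : ℝ) - ν = -ν + 1 by ring, rpow_add_one hm.ne',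
    show -ν + 1 = (1 : ℝ) - ν by ring]
  set e := exp (-((X + Y + Z) / 2))
  calc _ = t * s ^ (-(3 / 2) : ℝ) * m ^ (-ν) * e * e / (x - exp (-s) * a) *
        (m * |(-3 / (2 * s) + t ^ 2 / (4 * s ^ 2) + (1 - ν) * (2 * exp (-s) ^ 2) / m +
      p * (2 * exp (-s) ^ 2) / m ^ 2 - exp (-s) * a / (x - exp (-s) * a))|) := by ring
    _ ≤ t * s ^ (-(3 / 2) : ℝ) * m ^ (-ν) * e * e / (x - exp (-s) * a) *
        ((7 + 2 * |1 - ν|) * (1 + (X + Y + Z) / 2) / (1 + s)) := by gcongr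
    _ = (7 + 2 * |1 - ν|) * (t * s ^ (-(3 / 2) : ℝ) * m ^ (-ν) * e) *
        (e * (1 + (X + Y + Z) / 2)) / ((x - exp (-s) * a) * (1 + s)) := by
          field_simp
    _ ≤ (7 + 2 * |1 - ν|) * (t * s ^ (-(3 / 2) : ℝ) * m ^ (-ν) * e) *
        1 / ((x - exp (-s) * a) * (1 + s)) := by gcongr
    _ = _ := by rw [mul_one]

/-! ### Pointwise estimates of the integrands -/

noncomputable section

/-- Majorant leading to `Z₁`; here `w = |x - y|²`. -/
def nearMajorant (ν t w x s : ℝ) : ℝ :=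
  t * (s ^ (-(ν + 1 + 1)) * exp (-((t ^ 2 + w) / 2000 / s))) * exp (-(t * (1 + x) / 4000))

/-- Majorant leading to `Z₃`; here `b = |y|²`. -/
def farMajorant (t b x : ℝ) : ℝ → ℝ :=
  (Ici (1 / 5)).indicator fun s =>
    t * (s ^ (-(3 / 2 + 1) : ℝ) * exp (-(t ^ 2 / 1000 / s))) * exp (-(b / 1000)) / (1 + x)

/-- Majorant leading to `Z₂`; here `u = (x₁ - y₁) / x₁`. -/
def localMajorant (ν t p a x u s : ℝ) : ℝ :=
  t * u ^ (-(ν + 3 / 2)) * exp (-((t ^ 2 + p) / (1000 * u))) / (x - a) *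
    (exp (-s) * exp (-(1 / (1000 * u) * (x * exp (-s) - a) ^ 2)))

/-- Majorant leading to `Z₄`; here `L = log (x₁ / y₁)`. -/
def logMajorant (t p a x L s : ℝ) : ℝ :=
  t * L ^ (-(5 / 2) : ℝ) * exp (-(t ^ 2 / (1000 * L))) * exp (-(p / 1000)) / (x * a) *
    (x * exp (-s) * exp (-(1 / 1000 * (x * exp (-s) - a) ^ 2)))

end

lemma nearMajorant_nonneg {ν t w x s : ℝ} (ht : 0 < t) (hs : 0 < s) :
    0 ≤ nearMajorant ν t w x s := by
  unfold nearMajorant; positivity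

lemma farMajorant_nonneg {t b x : ℝ} (ht : 0 < t) (hx : 0 ≤ x) (s : ℝ) :
    0 ≤ farMajorant t b x s := by
  refine indicator_nonneg (fun s hs => ?_) s
  have : 0 < s := lt_of_lt_of_le (by norm_num) hs
  positivity

lemma localMajorant_nonneg {ν t p a x u s : ℝ} (ht : 0 < t) (hax : a < x) (hu : 0 < u) :
    0 ≤ localMajorant ν t p a x u s := by
  have : 0 < x - a := sub_pos.2 hax
  unfold localMajorant; positivity

lemma logMajorant_nonneg {t p a x L s : ℝ} (ht : 0 < t) (ha : 0 < a) (hx : 0 < x) (hL : 0 < L) :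
    0 ≤ logMajorant t p a x L s := by
  unfold logMajorant; positivity

lemma add_div_four_mul_le_halfExponent {t p a x s : ℝ} (hp : 0 ≤ p) (hs : 0 < s) :
    t ^ 2 / (8 * s) + ((a - exp (-s) * x) ^ 2 + p) / (4 * s) ≤ halfExponent t p a x s := by
  have := one_sub_exp_neg_sq_pos hs
  unfold halfExponent
  have h : 2 * (1 - exp (-s) ^ 2) ≤ 4 * s := by linarith [one_sub_exp_neg_sq_le (s := s)]
  gcongr

lemma add_div_two_le_halfExponent {t p a x s : ℝ} (hp : 0 ≤ p) (hs : 0 < s) :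
    t ^ 2 / (8 * s) + ((a - exp (-s) * x) ^ 2 + p) / 2 ≤ halfExponent t p a x s := by
  have := one_sub_exp_neg_sq_pos hs
  unfold halfExponent
  have h : 2 * (1 - exp (-s) ^ 2) ≤ 2 := by linarith [one_sub_exp_neg_sq_le_one s]
  gcongr

/-- The allowance s in `hmain` becomes an additive 1 after division by s, which only costs a factor
e. The constant 1000 is generous and leaves room in every regime. -/
lemma le_halfExponent_add_one {t p a x s : ℝ} (hp : 0 ≤ p) (hs : 0 < s)
    (hmain : ((x - a) ^ 2 + (s * x) ^ 2) / 1000 ≤ (a - exp (-s) * x) ^ 2 / 4 + s) :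
    (t ^ 2 + ((x - a) ^ 2 + p)) / (1000 * s) + s * x ^ 2 / 1000 ≤
      halfExponent t p a x s + 1 := by
  refine le_trans ?_ (add_le_add_left (add_div_four_mul_le_halfExponent hp hs) 1)
  rw [← sub_nonneg]
  have : t ^ 2 / (8 * s) + ((a - exp (-s) * x) ^ 2 + p) / (4 * s) + 1 -
    ((t ^ 2 + ((x - a) ^ 2 + p)) / (1000 * s) + s * x ^ 2 / 1000) =
    (t ^ 2 * (1 / 8 - 1 / 1000) + p * (1 / 4 - 1 / 1000) +
      ((a - exp (-s) * x) ^ 2 / 4 + s - ((x - a) ^ 2 + (s * x) ^ 2) / 1000)) / s := by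
    field_simp; ring
  rw [this]
  have := sq_nonneg t
  exact div_nonneg (by linarith) hs.le

/-- Part of t²/s is set aside to produce e^{-ct(1+x)}: with s x² it yields tx, and with s ≤ 2 it
yields t. The factor h, of size s^{-1/2}, completes the power s^{-(ν+2)}. -/
lemma envelope_mul_le_nearMajorant {ν t p a x w s h K : ℝ} (hν : 0 ≤ ν) (ht : 0 < t)
    (hw : 0 ≤ w) (hs : 0 < s) (hs2 : s ≤ 2)
    (hE : (t ^ 2 + w) / (1000 * s) + s * x ^ 2 / 1000 ≤ halfExponent t p a x s + 1)
    (hh : h ≤ K * s ^ (-(1 / 2) : ℝ)) (hK : 0 ≤ K) :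
    envelope ν t p a x s * h ≤ (5 / 2) ^ ν * exp 2 * K * nearMajorant ν t w x s := by
  have hm := one_sub_exp_neg_sq_pos hs
  have h1 : exp (-halfExponent t p a x s) ≤
      exp 2 * (exp (-((t ^ 2 + w) / 2000 / s)) * exp (-(t * (1 + x) / 4000))) := by
    rw [← exp_add, ← exp_add, exp_le_exp]
    have e1 : (t ^ 2 + w) / (1000 * s) =
      (t ^ 2 + w) / 2000 / s + t ^ 2 / (2000 * s) + w / (2000 * s) := by
      field_simp; ring
    have e5 : 0 ≤ w / (2000 * s) := by positivity
    -- Arithmetic-geometric mean inequality; the product of the two terms does not depend on s.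
    have e2 : t * x / 4000 ≤ t ^ 2 / (4000 * s) + s * x ^ 2 / 1000 := by
      have : t ^ 2 / (4000 * s) + s * x ^ 2 / 1000 - t * x / 1000 =
        (t - 2 * s * x) ^ 2 / (4000 * s) := by field_simp; ring
      have h3 : 0 ≤ (t - 2 * s * x) ^ 2 / (4000 * s) := by positivity
      have h4 : 0 ≤ t ^ 2 / (4000 * s) + s * x ^ 2 / 1000 := by positivity
      nlinarith
    have e3 : t / 4000 ≤ t ^ 2 / (4000 * s) + 1 := by
      have : t ^ 2 / (4000 * 2) ≤ t ^ 2 / (4000 * s) := by gcongr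
      nlinarith [sq_nonneg (t - 1)]
    have e4 : t ^ 2 / (2000 * s) = t ^ 2 / (4000 * s) + t ^ 2 / (4000 * s) := by
      field_simp; norm_num
    linarith
  have h2 := one_sub_exp_neg_sq_rpow_le_of_le_two hs hs2 hν
  have h3 : s ^ (-(ν + 1 + 1)) = s ^ (-(3 / 2) : ℝ) * s ^ (-ν) * s ^ (-(1 / 2) : ℝ) := by
    rw [← rpow_add hs, ← rpow_add hs]; congr 1; ring
  calc envelope ν t p a x s * h ≤ envelope ν t p a x s * (K * s ^ (-(1 / 2) : ℝ)) :=
        mul_le_mul_of_nonneg_left hh (envelope_nonneg ht hs)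
    _ ≤ t * s ^ (-(3 / 2) : ℝ) * ((5 / 2) ^ ν * s ^ (-ν)) *
        (exp 2 * (exp (-((t ^ 2 + w) / 2000 / s)) * exp (-(t * (1 + x) / 4000)))) *
          (K * s ^ (-(1 / 2) : ℝ)) := by
        unfold envelope; gcongr
    _ = _ := by rw [nearMajorant, h3]; ring

/-- E is spare exponent. Without integration by parts it is x²/1000 - 1 and provides the decay in x;
after it E = -1, a mere loss, since 1/(x - ra) supplies that decay. -/
lemma envelope_mul_le_farMajorant {ν t p a x s h E K : ℝ} (hν : 0 ≤ ν) (ht : 0 < t)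
    (hs : 1 / 5 ≤ s)
    (hE : t ^ 2 / (1000 * s) + (a ^ 2 + p) / 1000 + E ≤ halfExponent t p a x s)
    (hh0 : 0 ≤ h) (hh : h * exp (-E) ≤ K * (s⁻¹ * (1 + x)⁻¹)) :
    envelope ν t p a x s * h ≤ (7 / 2) ^ ν * K * farMajorant t (a ^ 2 + p) x s := by
  have hs0 : 0 < s := lt_of_lt_of_le (by norm_num) hs
  have hm := one_sub_exp_neg_sq_pos hs0
  have h2 := one_sub_exp_neg_sq_rpow_le_of_le hs hν
  have h1 : exp (-halfExponent t p a x s) ≤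
      exp (-(t ^ 2 / 1000 / s)) * exp (-((a ^ 2 + p) / 1000)) * exp (-E) := by
    rw [← exp_add, ← exp_add, exp_le_exp, div_div]
    linarith
  have h3 : s ^ (-(3 / 2 + 1) : ℝ) = s ^ (-(3 / 2) : ℝ) * s⁻¹ := by
    rw [← rpow_neg_one, ← rpow_add hs0]; congr 1; ring
  rw [farMajorant, indicator_of_mem (by exact hs), h3]
  calc envelope ν t p a x s * h ≤ t * s ^ (-(3 / 2) : ℝ) * (7 / 2) ^ ν *
        (exp (-(t ^ 2 / 1000 / s)) * exp (-((a ^ 2 + p) / 1000)) * exp (-E)) * h := by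
        unfold envelope; gcongr
    _ = t * s ^ (-(3 / 2) : ℝ) * (7 / 2) ^ ν *
        (exp (-(t ^ 2 / 1000 / s)) * exp (-((a ^ 2 + p) / 1000))) * (h * exp (-E)) := by ring
    _ ≤ t * s ^ (-(3 / 2) : ℝ) * (7 / 2) ^ ν *
        (exp (-(t ^ 2 / 1000 / s)) * exp (-((a ^ 2 + p) / 1000))) * (K * (s⁻¹ * (1 + x)⁻¹)) := by
        gcongr
    _ = _ := by rw [div_eq_mul_inv _ (1 + x)]; ring

lemma exp_neg_le_inv {s : ℝ} (hs : 0 < s) : exp (-s) ≤ s⁻¹ := by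
  rw [le_inv_comm₀ (exp_pos _) hs, exp_neg, inv_inv]
  linarith [add_one_le_exp s]

lemma exp_neg_sq_le {x : ℝ} (hx : 0 ≤ x) : exp (-(x ^ 2 / 1000)) ≤ 251 * (1 + x)⁻¹ := by
  have h := exp_neg_mul_one_add_le_one (s := x ^ 2 / 1000) (by positivity)
  rw [← div_eq_mul_inv, le_div_iff₀ (by linarith)]
  -- From (x - 500)² ≥ 0 one gets x ≤ 250 + x²/1000; hence 251.
  have : 1 + x ≤ 251 * (1 + x ^ 2 / 1000) := by nlinarith [sq_nonneg (x - 500)]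
  nlinarith [exp_pos (-(x ^ 2 / 1000))]

lemma div_three_le_one_sub_exp_neg {s : ℝ} (hs : 0 < s) (hs2 : s ≤ 2) :
    s / 3 ≤ 1 - exp (-s) := by
  have h := exp_neg_mul_one_add_le_one hs.le
  have h1 : exp (-s) < 1 := by simpa using hs
  nlinarith [exp_pos (-s)]

lemma one_sub_exp_neg_le (s : ℝ) : 1 - exp (-s) ≤ s := by linarith [add_one_le_exp (-s)]

lemma exp_neg_le_fourth {s : ℝ} (hs : 2 ≤ s) : exp (-s) ≤ 1 / 4 := by
  have h1 : exp (-s) ≤ exp (-1) * exp (-1) := by rw [← exp_add, exp_le_exp]; linarith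
  have h2 := exp_neg_mul_one_add_le_one (s := 1) (by norm_num)
  nlinarith [exp_pos (-1)]

lemma ninth_le_exp_neg {s : ℝ} (hs : s ≤ 2) : 1 / 9 ≤ exp (-s) := by
  have h1 : exp (-1) * exp (-1) ≤ exp (-s) := by rw [← exp_add, exp_le_exp]; linarith
  have h2 : 1 / 3 ≤ exp (-1) := by
    rw [exp_neg, ← one_div]
    exact one_div_le_one_div_of_le (exp_pos 1) (by linarith [exp_one_lt_d9])
  nlinarith

lemma le_add_mul_add_left {z c₁ c₂ u v : ℝ} (h : z ≤ c₁ * u) (h1 : 0 ≤ c₁) (h2 : 0 ≤ c₂)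
    (hu : 0 ≤ u) (hv : 0 ≤ v) : z ≤ (c₁ + c₂) * (u + v) := by
  nlinarith [mul_nonneg h1 hv, mul_nonneg h2 hv, mul_nonneg h2 hu]

lemma le_add_mul_add_right {z c₁ c₂ u v : ℝ} (h : z ≤ c₂ * v) (h1 : 0 ≤ c₁) (h2 : 0 ≤ c₂)
    (hu : 0 ≤ u) (hv : 0 ≤ v) : z ≤ (c₁ + c₂) * (u + v) := by
  nlinarith [mul_nonneg h1 hv, mul_nonneg h1 hu, mul_nonneg h2 hu]

/-! ### Bounds for the original integrand. -/

lemma abs_dxIntegrand_le_nearMajorant {ν t p a x s : ℝ} (hν : 0 ≤ ν) (ht : 0 < t) (hp : 0 ≤ p)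
    (hx : 0 ≤ x) (hs : 0 < s) (hs2 : s ≤ 2) (hcase : x ≤ 1 ∨ x * (x - a) ≤ 1) :
    |dxIntegrand ν t p a x s| ≤ (5 / 2) ^ ν * exp 2 * (2 * (5 / 2) ^ (1 / 2 : ℝ)) *
      nearMajorant ν t ((x - a) ^ 2 + p) x s := by
  have hr1 : exp (-s) < 1 := by simpa using hs
  have hm := one_sub_exp_neg_sq_pos hs
  have hv1 := div_three_le_one_sub_exp_neg hs hs2
  have hv2 := one_sub_exp_neg_le s
  have hmain : ((x - a) ^ 2 + (s * x) ^ 2) / 1000 ≤ (a - exp (-s) * x) ^ 2 / 4 + s := by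
    rcases hcase with hx1 | hxa
    · have h1 : (x - a) ^ 2 ≤ 2 * (a - exp (-s) * x) ^ 2 + 2 * ((1 - exp (-s)) * x) ^ 2 := by
        linarith [sq_nonneg ((a - exp (-s) * x) + (1 - exp (-s)) * x)]
      have h2 : ((1 - exp (-s)) * x) ^ 2 ≤ s ^ 2 := by
        apply pow_le_pow_left₀ (mul_nonneg (by linarith) hx)
        nlinarith
      have h3 : (s * x) ^ 2 ≤ s ^ 2 := by
        apply pow_le_pow_left₀ (mul_nonneg hs.le hx)
        nlinarith
      nlinarith
    -- Expand the square of a - rx = (1 - r)x - (x - a). The cross term is at most 2s because x(x -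
    -- a) ≤ 1, and the allowance s in the claim pays for it.
    · have h1 : (s * x / 3) ^ 2 ≤ ((1 - exp (-s)) * x) ^ 2 := by
        apply pow_le_pow_left₀ (by positivity)
        nlinarith
      have h2 : (1 - exp (-s)) * (x * (x - a)) ≤ s := by
        rcases le_total 0 (x * (x - a)) with h | h <;> nlinarith
      nlinarith [sq_nonneg (x - a)]
  have key := le_halfExponent_add_one (t := t) hp hs hmain
  have hh : 2 * exp (-s) * (1 - exp (-s) ^ 2) ^ (-(1 / 2) : ℝ) ≤
      2 * (5 / 2) ^ (1 / 2 : ℝ) * s ^ (-(1 / 2) : ℝ) := by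
    have := one_sub_exp_neg_sq_rpow_le_of_le_two hs hs2 (b := 1 / 2) (by norm_num)
    calc _ ≤ 2 * 1 * ((5 / 2) ^ (1 / 2 : ℝ) * s ^ (-(1 / 2) : ℝ)) := by gcongr
      _ = _ := by ring
  refine le_trans ?_ (envelope_mul_le_nearMajorant hν ht (by positivity) hs hs2 key hh
    (by positivity))
  exact (abs_dxIntegrand_le ht hp hs).trans_eq (by ring)

lemma abs_dxIntegrand_le_farMajorant {ν t p a x s : ℝ} (hν : 0 ≤ ν) (ht : 0 < t) (hp : 0 ≤ p)
    (hx : 0 ≤ x) (hs2 : 2 ≤ s) (hcase : x ≤ 1 ∨ x / 2 ≤ a) :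
    |dxIntegrand ν t p a x s| ≤ (7 / 2) ^ ν * (2 * (7 / 2) ^ (1 / 2 : ℝ) * 251 * exp 1) *
      farMajorant t (a ^ 2 + p) x s := by
  have hs : 0 < s := by linarith
  have hm := one_sub_exp_neg_sq_pos hs
  have hr0 := exp_pos (-s)
  have hr4 := exp_neg_le_fourth hs2
  -- Here r ≤ 1/4, so rx is bounded when x ≤ 1 and is at most a/2 when x ≤ 2a.
  have h2 : a ^ 2 / 1000 + x ^ 2 / 1000 ≤ (a - exp (-s) * x) ^ 2 / 2 + 1 := by
    rcases hcase with hx1 | hxa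
    · have h3 : (exp (-s) * x) ^ 2 ≤ 1 := by
        rw [sq_le_one_iff_abs_le_one, abs_of_nonneg (by positivity)]
        nlinarith
      have h4 : x ^ 2 ≤ 1 := by nlinarith
      linarith [sq_nonneg (a - 2 * (exp (-s) * x)), sq_nonneg a]
    · have h3 : a / 2 ≤ a - exp (-s) * x := by nlinarith
      have h4 : (a / 2) ^ 2 ≤ (a - exp (-s) * x) ^ 2 :=
        pow_le_pow_left₀ (by linarith) h3 2
      have h5 : (x / 2) ^ 2 ≤ a ^ 2 := pow_le_pow_left₀ (by linarith) hxa 2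
      linarith [sq_nonneg a]
  have key : t ^ 2 / (1000 * s) + (a ^ 2 + p) / 1000 + (x ^ 2 / 1000 - 1) ≤
      halfExponent t p a x s := by
    refine le_trans ?_ (add_div_two_le_halfExponent hp hs)
    have h1 : t ^ 2 / (1000 * s) ≤ t ^ 2 / (8 * s) := by gcongr; norm_num
    linarith
  have hh : 2 * exp (-s) * (1 - exp (-s) ^ 2) ^ (-(1 / 2) : ℝ) * exp (-(x ^ 2 / 1000 - 1)) ≤
      2 * (7 / 2) ^ (1 / 2 : ℝ) * 251 * exp 1 * (s⁻¹ * (1 + x)⁻¹) := by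
    have h1 := one_sub_exp_neg_sq_rpow_le_of_le (s := s) (b := 1 / 2) (by linarith) (by norm_num)
    have h2 := exp_neg_sq_le hx
    have h3 : exp (-(x ^ 2 / 1000 - 1)) = exp 1 * exp (-(x ^ 2 / 1000)) := by
      rw [← exp_add]; congr 1; ring
    have h4 := exp_neg_le_inv hs
    rw [h3]
    calc _ ≤ 2 * s⁻¹ * (7 / 2) ^ (1 / 2 : ℝ) * (exp 1 * (251 * (1 + x)⁻¹)) := by gcongr
      _ = _ := by ring
  refine le_trans ?_ (envelope_mul_le_farMajorant hν ht (by linarith) key (by positivity) hh)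
  exact (abs_dxIntegrand_le ht hp hs).trans_eq (by ring)

/-- Without cancellation: `x₁` bounded, or `y₁` not much smaller than `x₁`. -/
lemma exists_abs_dxIntegrand_le {ν : ℝ} (hν : 0 ≤ ν) :
    ∃ C : ℝ, 0 < C ∧ ∀ t p a x s : ℝ, 0 < t → 0 ≤ p → 0 ≤ x → 0 < s →
      (x ≤ 1 ∨ (x / 2 ≤ a ∧ x * (x - a) ≤ 1)) →
      |dxIntegrand ν t p a x s| ≤
        C * (nearMajorant ν t ((x - a) ^ 2 + p) x s + farMajorant t (a ^ 2 + p) x s) := by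
  refine ⟨(5 / 2) ^ ν * exp 2 * (2 * (5 / 2) ^ (1 / 2 : ℝ)) +
    (7 / 2) ^ ν * (2 * (7 / 2) ^ (1 / 2 : ℝ) * 251 * exp 1), by positivity, ?_⟩
  intro t p a x s ht hp hx hs hcase
  have hN := nearMajorant_nonneg (ν := ν) (w := (x - a) ^ 2 + p) (x := x) ht hs
  have hF := farMajorant_nonneg (b := a ^ 2 + p) ht hx s
  rcases le_total s 2 with hs2 | hs2
  · exact le_add_mul_add_left (abs_dxIntegrand_le_nearMajorant hν ht hp hx hs hs2
      (hcase.imp_right And.right)) (by positivity) (by positivity) hN hF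
  · exact le_add_mul_add_right (abs_dxIntegrand_le_farMajorant hν ht hp hx hs2
      (hcase.imp_right And.left)) (by positivity) (by positivity) hN hF

/-! ### Bounds for the integrand after integration by parts. -/

lemma abs_partsIntegrand_le_nearMajorant {ν t p a x s : ℝ} (hν : 0 ≤ ν) (ht : 0 < t) (hp : 0 ≤ p)
    (hx : 1 ≤ x) (hax : a < x) (hs : 0 < s) (hs2 : s ≤ 2)
    (hmain : ((x - a) ^ 2 + (s * x) ^ 2) / 1000 ≤ (a - exp (-s) * x) ^ 2 / 4 + s)
    (hq : 2 / 9 * √s ≤ x - exp (-s) * a) :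
    |partsIntegrand ν t p a x s| ≤ (7 + 2 * |1 - ν|) * ((5 / 2) ^ ν * exp 2 * (9 / 2)) *
      nearMajorant ν t ((x - a) ^ 2 + p) x s := by
  have key := le_halfExponent_add_one (t := t) hp hs hmain
  have hss : 0 < √s := sqrt_pos.2 hs
  have hh : ((x - exp (-s) * a) * (1 + s))⁻¹ ≤ 9 / 2 * s ^ (-(1 / 2) : ℝ) := by
    rw [rpow_neg hs.le, ← sqrt_eq_rpow, show (9 : ℝ) / 2 = (2 / 9)⁻¹ by norm_num, ← mul_inv]
    apply inv_anti₀ (by positivity)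
    nlinarith
  have h1 := envelope_mul_le_nearMajorant hν ht (by positivity) hs hs2 key hh (by norm_num)
  refine (abs_partsIntegrand_le ht hp hs hx hax).trans ?_
  rw [div_eq_mul_inv, mul_assoc, mul_assoc (7 + 2 * |1 - ν|)]
  gcongr

lemma abs_partsIntegrand_le_farMajorant {ν t p a x s : ℝ} (hν : 0 ≤ ν) (ht : 0 < t) (hp : 0 ≤ p)
    (hx : 1 ≤ x) (hax : a < x) (hs : 1 / 5 ≤ s)
    (hmain : a ^ 2 / 1000 ≤ (a - exp (-s) * x) ^ 2 / 2 + 1)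
    (hq : x / 2 ≤ x - exp (-s) * a) :
    |partsIntegrand ν t p a x s| ≤ (7 + 2 * |1 - ν|) * ((7 / 2) ^ ν * (4 * exp 1)) *
      farMajorant t (a ^ 2 + p) x s := by
  have hs0 : 0 < s := by linarith
  have key : t ^ 2 / (1000 * s) + (a ^ 2 + p) / 1000 + (-1) ≤ halfExponent t p a x s := by
    refine le_trans ?_ (add_div_two_le_halfExponent hp hs0)
    have h1 : t ^ 2 / (1000 * s) ≤ t ^ 2 / (8 * s) := by gcongr; norm_num
    linarith
  have hh0 : 0 ≤ ((x - exp (-s) * a) * (1 + s))⁻¹ :=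
    inv_nonneg.2 (mul_nonneg (by linarith) (by linarith))
  have hh : ((x - exp (-s) * a) * (1 + s))⁻¹ * exp (-(-1)) ≤ 4 * exp 1 * (s⁻¹ * (1 + x)⁻¹) := by
    have h2 : ((x - exp (-s) * a) * (1 + s))⁻¹ ≤ ((1 + x) / 4 * s)⁻¹ := by
      apply inv_anti₀ (by positivity)
      gcongr <;> linarith
    calc _ ≤ ((1 + x) / 4 * s)⁻¹ * exp 1 := by rw [neg_neg]; gcongr
      _ = _ := by rw [mul_inv, inv_div]; ring
  have h1 := envelope_mul_le_farMajorant hν ht hs key hh0 hh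
  refine (abs_partsIntegrand_le ht hp hs0 hx hax).trans ?_
  rw [div_eq_mul_inv, mul_assoc, mul_assoc (7 + 2 * |1 - ν|)]
  gcongr

lemma half_le_sub_exp_neg_mul {a x s : ℝ} (hs : 0 < s) (hx : 1 ≤ x) (hax : a ≤ x / 2) :
    x / 2 ≤ x - exp (-s) * a := by
  have h1 : exp (-s) < 1 := by simpa using hs
  have h0 := exp_pos (-s)
  rcases le_total a 0 with h | h <;> nlinarith

lemma abs_partsIntegrand_le_nearMajorant_of_le_fifth {ν t p a x s : ℝ} (hν : 0 ≤ ν) (ht : 0 < t)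
    (hp : 0 ≤ p) (hx : 1 ≤ x) (hax : a < x / 2) (hs : 0 < s) (hs5 : s ≤ 1 / 5) :
    |partsIntegrand ν t p a x s| ≤ (7 + 2 * |1 - ν|) * ((5 / 2) ^ ν * exp 2 * (9 / 2)) *
      nearMajorant ν t ((x - a) ^ 2 + p) x s := by
  refine abs_partsIntegrand_le_nearMajorant hν ht hp hx (by linarith) hs (by linarith) ?_ ?_
  · have h1 := one_sub_exp_neg_le s
    -- Since x < 2(x - a) and 1 - r ≤ 1/5, moving from x to rx costs at most 2/5 of x - a.
    have h2 : 3 / 5 * (x - a) ≤ exp (-s) * x - a := by nlinarith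
    have h3 : (3 / 5 * (x - a)) ^ 2 ≤ (exp (-s) * x - a) ^ 2 :=
      pow_le_pow_left₀ (by linarith) h2 2
    have h4 : (s * x) ^ 2 ≤ (x - a) ^ 2 := by
      apply pow_le_pow_left₀ (by positivity)
      nlinarith
    have h5 : (a - exp (-s) * x) ^ 2 = (exp (-s) * x - a) ^ 2 := by ring
    rw [h5]
    nlinarith [sq_nonneg (x - a)]
  · have h1 := half_le_sub_exp_neg_mul hs hx hax.le
    have h2 : √s ≤ 1 := sqrt_le_one.2 (by linarith)
    linarith

/-- After integration by parts, with `y₁ < x₁ / 2` and `y₁ ≤ 1`. -/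
lemma exists_abs_partsIntegrand_le_of_le_one {ν : ℝ} (hν : 0 ≤ ν) :
    ∃ C : ℝ, 0 < C ∧ ∀ t p a x s : ℝ, 0 < t → 0 ≤ p → 1 ≤ x → 0 < s → a < x / 2 → a ≤ 1 →
      |partsIntegrand ν t p a x s| ≤
        C * (nearMajorant ν t ((x - a) ^ 2 + p) x s + farMajorant t (a ^ 2 + p) x s) := by
  refine ⟨(7 + 2 * |1 - ν|) * ((5 / 2) ^ ν * exp 2 * (9 / 2)) +
    (7 + 2 * |1 - ν|) * ((7 / 2) ^ ν * (4 * exp 1)), by positivity, ?_⟩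
  intro t p a x s ht hp hx hs hax ha1
  have hN := nearMajorant_nonneg (ν := ν) (w := (x - a) ^ 2 + p) (x := x) ht hs
  have hF := farMajorant_nonneg (b := a ^ 2 + p) (x := x) ht (by linarith) s
  rcases le_total s (1 / 5) with hs5 | hs5
  · exact le_add_mul_add_left (abs_partsIntegrand_le_nearMajorant_of_le_fifth hν ht hp hx hax hs
      hs5) (by positivity) (by positivity) hN hF
  · refine le_add_mul_add_right (abs_partsIntegrand_le_farMajorant hν ht hp hx (by linarith) hs5 ?_
      (half_le_sub_exp_neg_mul hs hx hax.le)) (by positivity) (by positivity) hN hF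
    have hrx : 0 ≤ exp (-s) * x := by positivity
    rcases le_total 0 a with h | h <;> nlinarith [sq_nonneg (a - exp (-s) * x), sq_nonneg a]

/-- In this zone rx/a lies in [1/2, 3/2], so s differs from L = log(x/a) by a bounded amount. As L >
log 2, this makes s and L comparable, and powers of s become powers of L. -/
lemma abs_partsIntegrand_le_logMajorant {ν t p a x s : ℝ} (hν : 0 ≤ ν) (ht : 0 < t) (hp : 0 ≤ p)
    (hx : 1 ≤ x) (hs : 1 / 5 ≤ s) (ha : 1 < a) (hax : a < x / 2)
    (hzone : |a - exp (-s) * x| ≤ a / 2) :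
    |partsIntegrand ν t p a x s| ≤ (7 + 2 * |1 - ν|) * (4 * 3 ^ (5 / 2 : ℝ) * (7 / 2) ^ ν) *
      logMajorant t p a x (log (x / a)) s := by
  have hs0 : 0 < s := by linarith
  have ha0 : 0 < a := by linarith
  have hx0 : 0 < x := by linarith
  have hm := one_sub_exp_neg_sq_pos hs0
  obtain ⟨hz1, hz2⟩ := abs_le.1 hzone
  set L := log (x / a) with hL
  have hL2 : log 2 < L := by
    apply log_lt_log (by norm_num)
    rw [lt_div_iff₀ ha0]; linarith
  have hlog2 : 0 < log 2 := log_pos (by norm_num)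
  have hL0 : 0 < L := by linarith
  have hlogw : log (exp (-s) * x / a) = L - s := by
    rw [mul_div_assoc, log_mul (exp_pos _).ne' (by positivity), log_exp]; ring
  have hup : L - s ≤ log (3 / 2) := by
    rw [← hlogw]
    apply log_le_log (by positivity)
    rw [div_le_iff₀ ha0]; linarith
  have hlo : -log 2 ≤ L - s := by
    rw [← hlogw, ← log_inv]
    apply log_le_log (by norm_num)
    rw [le_div_iff₀ ha0]; linarith
  -- From 27/8 ≤ 4. It gives s ≥ L - (2/3) log 2 ≥ L/3.
  have h32 : log (3 / 2) ≤ 2 / 3 * log 2 := by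
    have h : log ((3 / 2) ^ 3) ≤ log (2 ^ 2) := log_le_log (by norm_num) (by norm_num)
    rw [log_pow, log_pow] at h
    push_cast at h
    linarith
  have hsL : s ≤ 2 * L := by linarith
  have hLs : L / 3 ≤ s := by linarith
  have hE : exp (-halfExponent t p a x s) ≤ exp (-(t ^ 2 / (1000 * L))) * exp (-(p / 1000)) *
      exp (-(1 / 1000 * (x * exp (-s) - a) ^ 2)) := by
    rw [← exp_add, ← exp_add, exp_le_exp]
    have h1 := add_div_two_le_halfExponent (t := t) (a := a) (x := x) hp hs0
    have h4 : 8 * s ≤ 1000 * L := by linarith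
    have h2 : t ^ 2 / (1000 * L) ≤ t ^ 2 / (8 * s) := by gcongr
    have h3 : (x * exp (-s) - a) ^ 2 = (a - exp (-s) * x) ^ 2 := by ring
    rw [h3]
    linarith [sq_nonneg (a - exp (-s) * x)]
  have hpow : s ^ (-(3 / 2) : ℝ) * s⁻¹ ≤ 3 ^ (5 / 2 : ℝ) * L ^ (-(5 / 2) : ℝ) := by
    rw [← rpow_neg_one, ← rpow_add hs0, show (-(3 / 2) + -1 : ℝ) = -(5 / 2) by norm_num,
      rpow_neg hs0.le, rpow_neg hL0.le, ← inv_rpow hs0.le, ← inv_rpow hL0.le,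
      ← mul_rpow (by norm_num) (by positivity)]
    apply rpow_le_rpow (by positivity) _ (by norm_num)
    rw [← div_eq_mul_inv, inv_le_comm₀ hs0 (by positivity), inv_div]
    exact hLs
  -- Since rx ≥ a/2, the Jacobian x e^{-s} of w = x e^{-s} can be inserted at the cost of 2/a.
  have hh : ((x - exp (-s) * a) * (1 + s))⁻¹ ≤ 4 * s⁻¹ * (x * a)⁻¹ * (x * exp (-s)) := by
    have h1 := half_le_sub_exp_neg_mul hs0 hx hax.le
    have h2 : ((x - exp (-s) * a) * (1 + s))⁻¹ ≤ (x / 2 * s)⁻¹ := by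
      apply inv_anti₀ (by positivity)
      nlinarith
    refine h2.trans ?_
    have h3 : 4 * s⁻¹ * (x * a)⁻¹ * (x * exp (-s)) - (x / 2 * s)⁻¹ =
        4 * (exp (-s) * x - a / 2) / (x * a * s) := by
      field_simp
      ring
    have h4 : 0 ≤ 4 * (exp (-s) * x - a / 2) / (x * a * s) :=
      div_nonneg (by linarith) (by positivity)
    linarith
  refine (abs_partsIntegrand_le ht hp hs0 hx (by linarith)).trans ?_
  rw [div_eq_mul_inv, mul_assoc, mul_assoc (7 + 2 * |1 - ν|)]
  refine mul_le_mul_of_nonneg_left ?_ (by positivity)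
  have hh0 : 0 ≤ ((x - exp (-s) * a) * (1 + s))⁻¹ :=
    inv_nonneg.2 (mul_nonneg (sub_exp_neg_mul_pos hs0 hx (by linarith)).le (by linarith))
  have hm' := one_sub_exp_neg_sq_rpow_le_of_le hs hν
  calc envelope ν t p a x s * ((x - exp (-s) * a) * (1 + s))⁻¹
      ≤ t * s ^ (-(3 / 2) : ℝ) * (7 / 2) ^ ν * (exp (-(t ^ 2 / (1000 * L))) * exp (-(p / 1000)) *
        exp (-(1 / 1000 * (x * exp (-s) - a) ^ 2))) *
          (4 * s⁻¹ * (x * a)⁻¹ * (x * exp (-s))) := by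
        unfold envelope; gcongr
    _ = t * (s ^ (-(3 / 2) : ℝ) * s⁻¹) * (7 / 2) ^ ν * (exp (-(t ^ 2 / (1000 * L))) *
        exp (-(p / 1000)) * exp (-(1 / 1000 * (x * exp (-s) - a) ^ 2))) *
          (4 * (x * a)⁻¹ * (x * exp (-s))) := by ring
    _ ≤ t * (3 ^ (5 / 2 : ℝ) * L ^ (-(5 / 2) : ℝ)) * (7 / 2) ^ ν * (exp (-(t ^ 2 / (1000 * L))) *
        exp (-(p / 1000)) * exp (-(1 / 1000 * (x * exp (-s) - a) ^ 2))) *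
          (4 * (x * a)⁻¹ * (x * exp (-s))) := by gcongr
    _ = _ := by rw [logMajorant]; ring

/-- After integration by parts, with `1 < y₁ < x₁ / 2`. -/
lemma exists_abs_partsIntegrand_le_of_one_lt {ν : ℝ} (hν : 0 ≤ ν) :
    ∃ C : ℝ, 0 < C ∧ ∀ t p a x s : ℝ, 0 < t → 0 ≤ p → 1 ≤ x → 0 < s → a < x / 2 → 1 < a →
      |partsIntegrand ν t p a x s| ≤
        C * (nearMajorant ν t ((x - a) ^ 2 + p) x s + farMajorant t (a ^ 2 + p) x s +
          logMajorant t p a x (log (x / a)) s) := by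
  refine ⟨(7 + 2 * |1 - ν|) * ((5 / 2) ^ ν * exp 2 * (9 / 2)) +
    (7 + 2 * |1 - ν|) * ((7 / 2) ^ ν * (4 * exp 1)) +
    (7 + 2 * |1 - ν|) * (4 * 3 ^ (5 / 2 : ℝ) * (7 / 2) ^ ν), by positivity, ?_⟩
  intro t p a x s ht hp hx hs hax ha1
  have hN := nearMajorant_nonneg (ν := ν) (w := (x - a) ^ 2 + p) (x := x) ht hs
  have hF := farMajorant_nonneg (b := a ^ 2 + p) (x := x) ht (by linarith) s
  have hL0 : 0 < log (x / a) := log_pos (by rw [lt_div_iff₀ (by linarith)]; linarith)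
  have hG := logMajorant_nonneg (p := p) (x := x) (s := s) ht (by linarith : 0 < a)
    (by linarith) hL0
  rcases le_total s (1 / 5) with hs5 | hs5
  · exact le_add_mul_add_left (le_add_mul_add_left
      (abs_partsIntegrand_le_nearMajorant_of_le_fifth hν ht hp hx hax hs hs5)
      (by positivity) (by positivity) hN hF) (by positivity) (by positivity) (by positivity) hG
  rcases le_total |a - exp (-s) * x| (a / 2) with hz | hz
  · exact le_add_mul_add_right (abs_partsIntegrand_le_logMajorant hν ht hp hx hs5 ha1 hax hz)
      (by positivity) (by positivity) (by positivity) hG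
  · refine le_add_mul_add_left (le_add_mul_add_right (abs_partsIntegrand_le_farMajorant hν ht hp hx
      (by linarith) hs5 ?_ (half_le_sub_exp_neg_mul hs hx hax.le)) (by positivity) (by positivity)
      hN hF) (by positivity) (by positivity) (by positivity) hG
    have h := pow_le_pow_left₀ (by linarith) hz 2
    rw [sq_abs] at h
    nlinarith [sq_nonneg a]

/-- When 1 - r is comparable to u ≤ 1/2, r stays above 1/4 and u/2 ≤ s ≤ 6u, so powers of s become
powers of u. The Gaussian in x e^{-s} - a is kept for the later integration. -/
lemma abs_partsIntegrand_le_localMajorant {ν t p a x u s : ℝ} (hν : 0 ≤ ν) (ht : 0 < t)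
    (hp : 0 ≤ p) (hx : 1 ≤ x) (hs : 0 < s) (hs2 : s ≤ 2) (hax : a < x) (hax2 : x / 2 ≤ a)
    (hu : x - a = u * x) (hz1 : u / 2 ≤ 1 - exp (-s)) (hz2 : 1 - exp (-s) ≤ 3 * u / 2) :
    |partsIntegrand ν t p a x s| ≤ (7 + 2 * |1 - ν|) * (4 * 2 ^ (ν + 3 / 2) * (5 / 2) ^ ν) *
      localMajorant ν t p a x u s := by
  have hx0 : 0 < x := by linarith
  have hm := one_sub_exp_neg_sq_pos hs
  have hd : 0 < x - a := by linarith
  have hu0 : 0 < u := by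
    rw [hu] at hd
    exact pos_of_mul_pos_left hd hx0.le
  have hu2 : u ≤ 1 / 2 := by
    have : u * x ≤ 1 / 2 * x := by linarith
    exact le_of_mul_le_mul_right this hx0
  have hr4 : 1 / 4 ≤ exp (-s) := by linarith
  have hr1 : exp (-s) < 1 := by simpa using hs
  have hs1 : u / 2 ≤ s := hz1.trans (one_sub_exp_neg_le s)
  have hs6 : s ≤ 6 * u := by
    have h := exp_neg_mul_one_add_le_one hs.le
    nlinarith
  have hE : exp (-halfExponent t p a x s) ≤ exp (-((t ^ 2 + p) / (1000 * u))) *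
      exp (-(1 / (1000 * u) * (x * exp (-s) - a) ^ 2)) := by
    rw [← exp_add, exp_le_exp]
    have h1 := add_div_four_mul_le_halfExponent (t := t) (a := a) (x := x) hp hs
    have h5 : 8 * s ≤ 1000 * u := by linarith
    have h6 : 4 * s ≤ 1000 * u := by linarith
    have h2 : t ^ 2 / (1000 * u) ≤ t ^ 2 / (8 * s) := by gcongr
    have h3 : 1 / (1000 * u) * (x * exp (-s) - a) ^ 2 + p / (1000 * u) =
        ((a - exp (-s) * x) ^ 2 + p) / (1000 * u) := by field_simp; ring
    have h4 : ((a - exp (-s) * x) ^ 2 + p) / (1000 * u) ≤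
        ((a - exp (-s) * x) ^ 2 + p) / (4 * s) := by gcongr
    rw [add_div]
    linarith
  have hpow : s ^ (-(3 / 2) : ℝ) * s ^ (-ν) ≤ 2 ^ (ν + 3 / 2) * u ^ (-(ν + 3 / 2)) := by
    rw [← rpow_add hs, show (-(3 / 2) + -ν : ℝ) = -(ν + 3 / 2) by ring,
      rpow_neg hs.le, rpow_neg hu0.le, ← inv_rpow hs.le, ← inv_rpow hu0.le,
      ← mul_rpow (by norm_num) (by positivity)]
    apply rpow_le_rpow (by positivity) _ (by positivity)
    rw [← div_eq_mul_inv, inv_le_comm₀ hs (by positivity), inv_div]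
    exact hs1
  have hh : ((x - exp (-s) * a) * (1 + s))⁻¹ ≤ 4 * (x - a)⁻¹ * exp (-s) := by
    have h1 : ((x - exp (-s) * a) * (1 + s))⁻¹ ≤ (x - a)⁻¹ := by
      apply inv_anti₀ hd
      have : x - a ≤ x - exp (-s) * a := by nlinarith
      nlinarith
    have h2 : 0 < (x - a)⁻¹ := by positivity
    nlinarith
  refine (abs_partsIntegrand_le ht hp hs hx hax).trans ?_
  rw [div_eq_mul_inv, mul_assoc, mul_assoc (7 + 2 * |1 - ν|)]
  refine mul_le_mul_of_nonneg_left ?_ (by positivity)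
  have hh0 : 0 ≤ ((x - exp (-s) * a) * (1 + s))⁻¹ :=
    inv_nonneg.2 (mul_nonneg (sub_exp_neg_mul_pos hs hx (by linarith)).le (by linarith))
  have hm' := one_sub_exp_neg_sq_rpow_le_of_le_two hs hs2 hν
  calc envelope ν t p a x s * ((x - exp (-s) * a) * (1 + s))⁻¹
      ≤ t * s ^ (-(3 / 2) : ℝ) * ((5 / 2) ^ ν * s ^ (-ν)) * (exp (-((t ^ 2 + p) / (1000 * u))) *
      exp (-(1 / (1000 * u) * (x * exp (-s) - a) ^ 2))) * (4 * (x - a)⁻¹ * exp (-s)) := by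
        unfold envelope; gcongr
    _ = t * (5 / 2) ^ ν * (s ^ (-(3 / 2) : ℝ) * s ^ (-ν)) * (exp (-((t ^ 2 + p) / (1000 * u))) *
      exp (-(1 / (1000 * u) * (x * exp (-s) - a) ^ 2))) * (4 * (x - a)⁻¹ * exp (-s)) := by ring
    _ ≤ t * (5 / 2) ^ ν * (2 ^ (ν + 3 / 2) * u ^ (-(ν + 3 / 2))) *
      (exp (-((t ^ 2 + p) / (1000 * u))) *
      exp (-(1 / (1000 * u) * (x * exp (-s) - a) ^ 2))) * (4 * (x - a)⁻¹ * exp (-s)) := by gcongr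
    _ = _ := by rw [localMajorant]; ring

/-- After integration by parts, with `x₁ / 2 ≤ y₁ < x₁` and `x₁ (x₁ - y₁) ≥ 1`. -/
lemma exists_abs_partsIntegrand_le_of_half_le {ν : ℝ} (hν : 0 ≤ ν) :
    ∃ C : ℝ, 0 < C ∧ ∀ t p a x u s : ℝ, 0 < t → 0 ≤ p → 1 ≤ x → 0 < s → x / 2 ≤ a → a < x →
      1 ≤ x * (x - a) → x - a = u * x →
      |partsIntegrand ν t p a x s| ≤
        C * (nearMajorant ν t ((x - a) ^ 2 + p) x s + farMajorant t (a ^ 2 + p) x s +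
          localMajorant ν t p a x u s) := by
  refine ⟨(7 + 2 * |1 - ν|) * ((5 / 2) ^ ν * exp 2 * (9 / 2)) +
    (7 + 2 * |1 - ν|) * ((7 / 2) ^ ν * (4 * exp 1)) +
    (7 + 2 * |1 - ν|) * (4 * 2 ^ (ν + 3 / 2) * (5 / 2) ^ ν), by positivity, ?_⟩
  intro t p a x u s ht hp hx hs hax2 hax hxa hu
  have hx0 : 0 < x := by linarith
  have hN := nearMajorant_nonneg (ν := ν) (w := (x - a) ^ 2 + p) (x := x) ht hs
  have hF := farMajorant_nonneg (b := a ^ 2 + p) (x := x) ht (by linarith) s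
  have hu0 : 0 < u := by
    have hd : 0 < x - a := by linarith
    rw [hu] at hd
    exact pos_of_mul_pos_left hd hx0.le
  have hG := localMajorant_nonneg (ν := ν) (p := p) (s := s) ht hax hu0
  have hr1 : exp (-s) < 1 := by simpa using hs
  have hr0 := exp_pos (-s)
  rcases le_total 2 s with hs2 | hs2
  · have hr4 := exp_neg_le_fourth hs2
    refine le_add_mul_add_left (le_add_mul_add_right (abs_partsIntegrand_le_farMajorant hν ht hp hx
      hax (by linarith) ?_ ?_) (by positivity) (by positivity)
      hN hF) (by positivity) (by positivity) (by positivity) hG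
    · have h3 : a / 2 ≤ a - exp (-s) * x := by nlinarith
      have h4 : (a / 2) ^ 2 ≤ (a - exp (-s) * x) ^ 2 := pow_le_pow_left₀ (by linarith) h3 2
      nlinarith [sq_nonneg a]
    · nlinarith
  -- Since a - rx = (1 - r - u)x, this isolates the neighbourhood of rx = a. Outside it |1 - r - u|
  -- dominates both u/2 and s/9, which gives the near bound.
  by_cases hz : u / 2 ≤ 1 - exp (-s) ∧ 1 - exp (-s) ≤ 3 * u / 2
  · exact le_add_mul_add_right (abs_partsIntegrand_le_localMajorant hν ht hp hx hs hs2 hax hax2 hu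
      hz.1 hz.2) (by positivity) (by positivity) (by positivity) hG
  · have hv := div_three_le_one_sub_exp_neg hs hs2
    refine le_add_mul_add_left (le_add_mul_add_left (abs_partsIntegrand_le_nearMajorant hν ht hp hx
      hax hs hs2 ?_ ?_) (by positivity) (by positivity)
      hN hF) (by positivity) (by positivity) (by positivity) hG
    · have he : a - exp (-s) * x = (1 - exp (-s) - u) * x := by linarith
      have h1 : (u / 2) ^ 2 ≤ (1 - exp (-s) - u) ^ 2 := by
        rw [not_and_or, not_le, not_le] at hz
        rcases hz with h | h
        · rw [← neg_sq (1 - exp (-s) - u)]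
          exact pow_le_pow_left₀ (by positivity) (by linarith) 2
        · exact pow_le_pow_left₀ (by positivity) (by linarith) 2
      have h2 : (s / 9) ^ 2 ≤ (1 - exp (-s) - u) ^ 2 := by
        rw [not_and_or, not_le, not_le] at hz
        rcases hz with h | h
        · rw [← neg_sq (1 - exp (-s) - u)]
          exact pow_le_pow_left₀ (by positivity) (by linarith) 2
        · exact pow_le_pow_left₀ (by positivity) (by linarith) 2
      have h3 : (u ^ 2 + s ^ 2) / 1000 ≤ (1 - exp (-s) - u) ^ 2 / 4 := by nlinarith
      rw [he, hu, mul_pow, mul_pow, mul_pow]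
      nlinarith [mul_le_mul_of_nonneg_right h3 (sq_nonneg x)]
    · have hr9 := ninth_le_exp_neg hs2
      have h1 : (s * x + (x - a)) / 9 ≤ x - exp (-s) * a := by nlinarith
      -- Arithmetic-geometric mean with x(x - a) ≥ 1. This is what lets 1/(x - ra) be replaced by a
      -- multiple of s^{-1/2}.
      have h2 : 2 * √s ≤ s * x + (x - a) := by
        apply le_of_sq_le_sq _ (by nlinarith)
        rw [mul_pow, sq_sqrt hs.le]
        nlinarith [sq_nonneg (s * x - (x - a))]
      linarith

/-! ### Integrability in `s` and the integration by parts formula -/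

/-- A dominating function for the integrands, independent of `x` and `y`. -/
noncomputable def dominator (b t s : ℝ) : ℝ :=
  (7 / 2) ^ b * (s ^ (-(1 / 2 + 1) : ℝ) * exp (-(t ^ 2 / 8 / s))) +
    (5 / 2) ^ b * (s ^ (-(1 / 2 + b + 1)) * exp (-(t ^ 2 / 8 / s)))

lemma integrableOn_dominator {b t : ℝ} (hb : 0 ≤ b) (ht : 0 < t) :
    IntegrableOn (dominator b t) (Ioi 0) :=
  ((integrableOn_rpow_mul_exp_neg_div (by norm_num) (by positivity)).const_mul _).add
    ((integrableOn_rpow_mul_exp_neg_div (by positivity) (by positivity)).const_mul _)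

lemma rpow_mul_exp_le_dominator {b t s E : ℝ} (hb : 0 ≤ b) (hs : 0 < s)
    (hE : t ^ 2 / (8 * s) ≤ E) :
    s ^ (-(3 / 2) : ℝ) * (1 - exp (-s) ^ 2) ^ (-b) * exp (-E) ≤ dominator b t s := by
  have hm := one_sub_exp_neg_sq_rpow_le hs hb
  have he : exp (-E) ≤ exp (-(t ^ 2 / 8 / s)) := by
    rw [exp_le_exp, div_div]; linarith
  have hpow : s ^ (-(1 / 2 + b + 1)) = s ^ (-(3 / 2) : ℝ) * s ^ (-b) := by
    rw [← rpow_add hs]; congr 1; ring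
  have hm0 := one_sub_exp_neg_sq_pos hs
  calc _ ≤ s ^ (-(3 / 2) : ℝ) * ((7 / 2) ^ b + (5 / 2) ^ b * s ^ (-b)) *
        exp (-(t ^ 2 / 8 / s)) := by gcongr
    _ = _ := by
        rw [dominator, hpow, show (-(1 / 2 + 1) : ℝ) = -(3 / 2) by norm_num]; ring

lemma sq_div_le_halfExponent {t p a x s : ℝ} (hp : 0 ≤ p) (hs : 0 < s) :
    t ^ 2 / (8 * s) ≤ halfExponent t p a x s := by
  have := one_sub_exp_neg_sq_pos hs
  exact le_add_of_nonneg_right (by positivity)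

lemma envelope_le_dominator {ν t p a x s : ℝ} (hν : 0 ≤ ν) (ht : 0 < t) (hp : 0 ≤ p)
    (hs : 0 < s) : envelope ν t p a x s ≤ t * dominator ν t s := by
  have h := rpow_mul_exp_le_dominator (b := ν) hν hs
    (sq_div_le_halfExponent (t := t) (a := a) (x := x) hp hs)
  calc _ = t * (s ^ (-(3 / 2) : ℝ) * (1 - exp (-s) ^ 2) ^ (-ν) *
        exp (-halfExponent t p a x s)) := by rw [envelope]; ring
    _ ≤ _ := by gcongr

lemma abs_dxIntegrand_le_dominator {ν t p a x s : ℝ} (hν : 0 ≤ ν) (ht : 0 < t) (hp : 0 ≤ p)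
    (hs : 0 < s) : |dxIntegrand ν t p a x s| ≤ 2 * (t * dominator (ν + 1 / 2) t s) := by
  have hm := one_sub_exp_neg_sq_pos hs
  have hr1 : exp (-s) ≤ 1 := by simpa using hs.le
  have h := rpow_mul_exp_le_dominator (b := ν + 1 / 2) (by positivity) hs
    (sq_div_le_halfExponent (t := t) (a := a) (x := x) hp hs)
  have hpow : (1 - exp (-s) ^ 2) ^ (-(ν + 1 / 2)) =
      (1 - exp (-s) ^ 2) ^ (-ν) * (1 - exp (-s) ^ 2) ^ (-(1 / 2) : ℝ) := by
    rw [← rpow_add hm]; congr 1; ring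
  have hn := envelope_nonneg (ν := ν) (p := p) (a := a) (x := x) ht hs
  calc _ ≤ 2 * envelope ν t p a x s * exp (-s) * (1 - exp (-s) ^ 2) ^ (-(1 / 2) : ℝ) :=
        abs_dxIntegrand_le ht hp hs
    _ ≤ 2 * envelope ν t p a x s * 1 * (1 - exp (-s) ^ 2) ^ (-(1 / 2) : ℝ) := by gcongr
    _ = 2 * (t * (s ^ (-(3 / 2) : ℝ) * (1 - exp (-s) ^ 2) ^ (-(ν + 1 / 2)) *
        exp (-halfExponent t p a x s))) := by rw [envelope, hpow]; ring
    _ ≤ _ := by gcongr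

lemma measurable_dxIntegrand (ν t p a x : ℝ) : Measurable (dxIntegrand ν t p a x) := by
  unfold dxIntegrand; fun_prop

lemma measurable_partsIntegrand (ν t p a x : ℝ) : Measurable (partsIntegrand ν t p a x) := by
  unfold partsIntegrand boundaryTerm; fun_prop

lemma integrableOn_dxIntegrand {ν t p : ℝ} (hν : 0 ≤ ν) (ht : 0 < t) (hp : 0 ≤ p) (a x : ℝ) :
    IntegrableOn (dxIntegrand ν t p a x) (Ioi 0) := by
  refine (((integrableOn_dominator (b := ν + 1 / 2) (by positivity) ht).const_mul t).const_mul
    2).mono' (measurable_dxIntegrand ν t p a x).aestronglyMeasurable ?_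
  filter_upwards [ae_restrict_mem measurableSet_Ioi] with s hs
  exact abs_dxIntegrand_le_dominator hν ht hp hs

lemma min_sub_one_le_sub_exp_neg_mul {a x s : ℝ} (hs : 0 < s) (hx : 1 ≤ x) :
    min (x - a) 1 ≤ x - exp (-s) * a := by
  have hr1 : exp (-s) ≤ 1 := by simpa using hs.le
  have hr0 := exp_pos (-s)
  rcases le_total a 0 with h | h
  · exact (min_le_right _ _).trans (by nlinarith)
  · exact (min_le_left _ _).trans (by nlinarith)

lemma integrableOn_partsIntegrand {ν t p a x : ℝ} (hν : 0 ≤ ν) (ht : 0 < t) (hp : 0 ≤ p)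
    (hx : 1 ≤ x) (hax : a < x) : IntegrableOn (partsIntegrand ν t p a x) (Ioi 0) := by
  have hκ : 0 < min (x - a) 1 := lt_min (by linarith) one_pos
  refine ((((integrableOn_dominator hν ht).const_mul t).const_mul
    (7 + 2 * |1 - ν|)).div_const (min (x - a) 1)).mono'
    (measurable_partsIntegrand ν t p a x).aestronglyMeasurable ?_
  filter_upwards [ae_restrict_mem measurableSet_Ioi] with s hs
  have hs0 : 0 < s := hs
  have h1 := min_sub_one_le_sub_exp_neg_mul (a := a) hs0 hx
  refine (abs_partsIntegrand_le ht hp hs0 hx hax).trans ?_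
  have h2 : min (x - a) 1 ≤ (x - exp (-s) * a) * (1 + s) := by nlinarith
  have h3 := envelope_le_dominator (a := a) (x := x) hν ht hp hs0
  have h4 := envelope_nonneg (ν := ν) (p := p) (a := a) (x := x) ht hs0
  have h5 : 0 ≤ t * dominator ν t s := h4.trans h3
  gcongr

lemma abs_boundaryTerm_le {ν t p a x s : ℝ} (hν : 0 ≤ ν) (ht : 0 < t) (hp : 0 ≤ p)
    (hx : 1 ≤ x) (hax : a < x) (hs : 0 < s) :
    |boundaryTerm ν t p a x s| ≤ t * dominator ν t s / min (x - a) 1 := by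
  have hκ : 0 < min (x - a) 1 := lt_min (by linarith) one_pos
  have h1 := min_sub_one_le_sub_exp_neg_mul (a := a) hs hx
  have hm := one_sub_exp_neg_sq_pos hs
  have hq := sub_exp_neg_mul_pos hs hx hax
  have h2 := rpow_mul_exp_le_dominator (b := ν) (t := t)
    (E := t ^ 2 / (4 * s) + ((a - exp (-s) * x) ^ 2 + p) / (1 - exp (-s) ^ 2)) hν hs (by
      have : t ^ 2 / (8 * s) ≤ t ^ 2 / (4 * s) := by gcongr; norm_num
      have h3 : 0 ≤ ((a - exp (-s) * x) ^ 2 + p) / (1 - exp (-s) ^ 2) := by positivity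
      linarith)
  have h5 : (1 - exp (-s) ^ 2) ^ (1 - ν) ≤ (1 - exp (-s) ^ 2) ^ (-ν) :=
    rpow_le_rpow_of_exponent_ge hm (one_sub_exp_neg_sq_le_one s) (by linarith)
  rw [boundaryTerm, abs_of_nonneg (by positivity)]
  have h6 : t * s ^ (-(3 / 2) : ℝ) * (1 - exp (-s) ^ 2) ^ (1 - ν) *
      exp (-(t ^ 2 / (4 * s)) - ((a - exp (-s) * x) ^ 2 + p) / (1 - exp (-s) ^ 2)) ≤
      t * dominator ν t s := by
    rw [← neg_add']
    calc _ ≤ t * s ^ (-(3 / 2) : ℝ) * (1 - exp (-s) ^ 2) ^ (-ν) *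
          exp (-(t ^ 2 / (4 * s) + ((a - exp (-s) * x) ^ 2 + p) / (1 - exp (-s) ^ 2))) := by
          gcongr
      _ = t * (s ^ (-(3 / 2) : ℝ) * (1 - exp (-s) ^ 2) ^ (-ν) *
          exp (-(t ^ 2 / (4 * s) + ((a - exp (-s) * x) ^ 2 + p) / (1 - exp (-s) ^ 2)))) := by ring
      _ ≤ _ := by gcongr
  have h7 : 0 ≤ t * dominator ν t s := le_trans (by positivity) h6
  gcongr

lemma tendsto_rpow_mul_exp_neg_div_zero {A : ℝ} (hA : 0 < A) (b : ℝ) :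
    Tendsto (fun s : ℝ => s ^ (-b) * exp (-(A / s))) (𝓝[>] 0) (𝓝 0) := by
  have h := (tendsto_rpow_mul_exp_neg_mul_atTop_nhds_zero b A hA).comp tendsto_inv_nhdsGT_zero
  refine h.congr' ?_
  filter_upwards [self_mem_nhdsWithin] with s hs
  have hs0 : (0 : ℝ) < s := hs
  rw [Function.comp_apply, inv_rpow hs0.le, ← rpow_neg hs0.le, neg_mul, div_eq_mul_inv]

lemma tendsto_rpow_mul_exp_neg_div_atTop {A b : ℝ} (hA : 0 < A) (hb : 0 < b) :
    Tendsto (fun s : ℝ => s ^ (-b) * exp (-(A / s))) atTop (𝓝 0) := by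
  refine squeeze_zero' ?_ ?_ (tendsto_rpow_neg_atTop hb)
  · filter_upwards [eventually_gt_atTop 0] with s hs
    positivity
  · filter_upwards [eventually_gt_atTop 0] with s hs
    have h : exp (-(A / s)) ≤ 1 := exp_le_one_iff.2 (neg_nonpos.2 (by positivity))
    exact mul_le_of_le_one_right (by positivity) h

lemma tendsto_dominator_zero {b t : ℝ} (ht : 0 < t) :
    Tendsto (dominator b t) (𝓝[>] 0) (𝓝 0) := by
  have h := ((tendsto_rpow_mul_exp_neg_div_zero (A := t ^ 2 / 8) (by positivity)
    (1 / 2 + 1)).const_mul ((7 / 2 : ℝ) ^ b)).add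
    ((tendsto_rpow_mul_exp_neg_div_zero (A := t ^ 2 / 8) (by positivity)
    (1 / 2 + b + 1)).const_mul ((5 / 2 : ℝ) ^ b))
  rw [mul_zero, mul_zero, add_zero] at h
  exact h

lemma tendsto_dominator_atTop {b t : ℝ} (hb : 0 ≤ b) (ht : 0 < t) :
    Tendsto (dominator b t) atTop (𝓝 0) := by
  have h := ((tendsto_rpow_mul_exp_neg_div_atTop (A := t ^ 2 / 8) (b := 1 / 2 + 1) (by positivity)
    (by positivity)).const_mul ((7 / 2 : ℝ) ^ b)).add
    ((tendsto_rpow_mul_exp_neg_div_atTop (A := t ^ 2 / 8) (b := 1 / 2 + b + 1) (by positivity)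
    (by positivity)).const_mul ((5 / 2 : ℝ) ^ b))
  rw [mul_zero, mul_zero, add_zero] at h
  exact h

/-- The boundary term vanishes at both ends: e^{-t²/(8s)} beats every power as s → 0, and s^{-3/2}
decays as s → ∞. -/
lemma integral_dxIntegrand_eq_integral_partsIntegrand {ν t p a x : ℝ} (hν : 0 ≤ ν) (ht : 0 < t)
    (hp : 0 ≤ p) (hx : 1 ≤ x) (hax : a < x) :
    ∫ s in Ioi (0 : ℝ), dxIntegrand ν t p a x s = ∫ s in Ioi (0 : ℝ), partsIntegrand ν t p a x s := by
  have hD := integrableOn_dxIntegrand hν ht hp a x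
  have hN := integrableOn_partsIntegrand hν ht hp hx hax
  -- The default value 0 ^ (-3/2) = 0 agrees with the limit, so the function is right-continuous at
  -- 0.
  have h0 : boundaryTerm ν t p a x 0 = 0 := by
    simp [boundaryTerm, zero_rpow (by norm_num : (-(3 / 2) : ℝ) ≠ 0)]
  have hlim : ∀ l : Filter ℝ, (∀ᶠ s in l, 0 < s) → Tendsto (dominator ν t) l (𝓝 0) →
      Tendsto (boundaryTerm ν t p a x) l (𝓝 0) := by
    intro l hl h
    have h' : Tendsto (fun s => t * dominator ν t s / min (x - a) 1) l (𝓝 0) := by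
      simpa using (h.const_mul t).div_const (min (x - a) 1)
    refine squeeze_zero_norm' ?_ h'
    filter_upwards [hl] with s hs
    exact abs_boundaryTerm_le hν ht hp hx hax hs
  have hcont : ContinuousWithinAt (boundaryTerm ν t p a x) (Ici 0) 0 := by
    rw [← continuousWithinAt_Ioi_iff_Ici, ContinuousWithinAt, h0]
    exact hlim _ self_mem_nhdsWithin (tendsto_dominator_zero ht)
  have hftc := integral_Ioi_of_hasDerivAt_of_tendsto hcont
    (fun s hs => hasDerivAt_boundaryTerm hs (sub_exp_neg_mul_pos hs hx hax)) (hN.sub hD)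
    (hlim _ (eventually_gt_atTop 0) (tendsto_dominator_atTop hν ht))
  rw [integral_sub hN hD, h0, sub_zero] at hftc
  linarith

/-! ### Integrals of the majorants -/

lemma integrableOn_nearMajorant {ν t w x : ℝ} (hν : 0 ≤ ν) (ht : 0 < t) (hw : 0 ≤ w) :
    IntegrableOn (nearMajorant ν t w x) (Ioi 0) :=
  ((integrableOn_rpow_mul_exp_neg_div (by positivity) (by positivity)).const_mul t).mul_const _

lemma integral_nearMajorant {ν t w x : ℝ} (hν : 0 ≤ ν) (ht : 0 < t) (hw : 0 ≤ w) :
    ∫ s in Ioi (0 : ℝ), nearMajorant ν t w x s = Gamma (ν + 1) * 2000 ^ (ν + 1) *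
      (t / (t ^ 2 + w) ^ (ν + 1) * exp (-(1 / 4000 * (t * (1 + x))))) := by
  unfold nearMajorant
  rw [integral_mul_const, integral_const_mul, integral_rpow_mul_exp_neg_div (by positivity)
    (by positivity), rpow_neg (by positivity), div_rpow (by positivity) (by norm_num), inv_div]
  rw [show -(t * (1 + x) / 4000) = -(1 / 4000 * (t * (1 + x))) by ring]
  ring

lemma integrableOn_farMajorant {t b x : ℝ} (ht : 0 < t) :
    IntegrableOn (farMajorant t b x) (Ioi 0) := by
  refine Integrable.indicator ?_ measurableSet_Ici
  exact (((integrableOn_rpow_mul_exp_neg_div (by norm_num) (by positivity)).const_mul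
    t).mul_const _).div_const _

/-- The two entries of the minimum come from dropping the exponential on [1/5, ∞), and from
extending the integral to (0, ∞), where it is a multiple of t⁻³. -/
lemma exists_integral_farMajorant_le :
    ∃ C : ℝ, 0 < C ∧ ∀ t b x : ℝ, 0 < t → 0 ≤ b → 0 ≤ x →
      ∫ s in Ioi (0 : ℝ), farMajorant t b x s ≤
        C * (min t ((t ^ 2)⁻¹) / (1 + x) * exp (-(1 / 4000 * b))) := by
  set A := ∫ s in Ici (1 / 5 : ℝ), s ^ (-(3 / 2 + 1) : ℝ) with hA
  have hA0 : 0 ≤ A := by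
    refine setIntegral_nonneg measurableSet_Ici fun s hs => ?_
    have : (0 : ℝ) < s := lt_of_lt_of_le (by norm_num) hs
    positivity
  have hAint : IntegrableOn (fun s : ℝ => s ^ (-(3 / 2 + 1) : ℝ)) (Ici (1 / 5)) := by
    rw [integrableOn_Ici_iff_integrableOn_Ioi]
    exact integrableOn_Ioi_rpow_of_lt (by norm_num) (by norm_num)
  set B := Gamma (3 / 2) * 1000 ^ (3 / 2 : ℝ) with hB
  have hB0 : 0 < B := mul_pos (Gamma_pos_of_pos (by norm_num)) (by positivity)
  refine ⟨A + B, by positivity, fun t b x ht hb hx => ?_⟩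
  have hint := integrableOn_rpow_mul_exp_neg_div (b := 3 / 2) (A := t ^ 2 / 1000) (by norm_num)
    (by positivity)
  have hsub : Ici (1 / 5 : ℝ) ⊆ Ioi 0 := Ici_subset_Ioi.2 (by norm_num)
  have h1 : ∫ s in Ici (1 / 5 : ℝ), s ^ (-(3 / 2 + 1) : ℝ) * exp (-(t ^ 2 / 1000 / s)) ≤ A := by
    refine setIntegral_mono_on (hint.mono_set hsub) hAint measurableSet_Ici fun s hs => ?_
    have hs0 : 0 < s := hsub hs
    have h : exp (-(t ^ 2 / 1000 / s)) ≤ 1 := exp_le_one_iff.2 (neg_nonpos.2 (by positivity))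
    exact mul_le_of_le_one_right (by positivity) h
  have h2 : ∫ s in Ici (1 / 5 : ℝ), s ^ (-(3 / 2 + 1) : ℝ) * exp (-(t ^ 2 / 1000 / s)) ≤
      B * (t ^ 3)⁻¹ := by
    refine (setIntegral_mono_set hint ?_ hsub.eventuallyLE).trans ?_
    · filter_upwards [ae_restrict_mem measurableSet_Ioi] with s hs
      have : 0 < s := hs
      simp only [Pi.zero_apply]
      positivity
    · rw [integral_rpow_mul_exp_neg_div (by norm_num) (by positivity), rpow_neg (by positivity),
        div_rpow (by positivity) (by norm_num), inv_div, hB, ← rpow_natCast t 2, ← rpow_mul ht.le,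
        ← rpow_natCast t 3]
      norm_num
      exact le_of_eq (by ring)
  set I := ∫ s in Ici (1 / 5 : ℝ), s ^ (-(3 / 2 + 1) : ℝ) * exp (-(t ^ 2 / 1000 / s)) with hI
  have hI0 : 0 ≤ I := by
    refine setIntegral_nonneg measurableSet_Ici fun s hs => ?_
    have : (0 : ℝ) < s := hsub hs
    positivity
  have h3 : ∫ s in Ioi (0 : ℝ), farMajorant t b x s = t * I * exp (-(b / 1000)) / (1 + x) := by
    unfold farMajorant
    rw [setIntegral_indicator measurableSet_Ici, inter_eq_right.2 hsub, integral_div,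
      integral_mul_const, integral_const_mul]
  have h4 : t * I ≤ (A + B) * min t ((t ^ 2)⁻¹) := by
    rw [mul_min_of_nonneg _ _ (by positivity)]
    refine le_min ?_ ?_
    · nlinarith
    · have h5 : t * (B * (t ^ 3)⁻¹) = B * (t ^ 2)⁻¹ := by field_simp
      have h6 : 0 ≤ A * (t ^ 2)⁻¹ := by positivity
      nlinarith
  have h5 : exp (-(b / 1000)) ≤ exp (-(1 / 4000 * b)) := by rw [exp_le_exp]; linarith
  rw [h3]
  calc _ ≤ (A + B) * min t ((t ^ 2)⁻¹) * exp (-(1 / 4000 * b)) / (1 + x) := by gcongr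
    _ = _ := by ring

lemma integrableOn_localMajorant {ν t p a x u : ℝ} (hx : 0 < x) (hu : 0 < u) :
    IntegrableOn (localMajorant ν t p a x u) (Ioi 0) := by
  have h := (integrableOn_exp_neg_mul_gaussian (b := 1 / (1000 * u)) hx (by positivity)
    a).const_mul x⁻¹
  refine Integrable.const_mul (h.congr (ae_of_all _ fun s => ?_)) _
  simp only
  rw [← mul_assoc, ← mul_assoc, inv_mul_cancel₀ hx.ne', one_mul]

/-- The Gaussian integral contributes √u/x, so the total power is u^{-(ν+2)}/x². Part of the factor
e^{-(t²+p)/(1000u)} is then spent on replacing u by the larger t² + u + p. -/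
lemma exists_integral_localMajorant_le {ν : ℝ} (hν : 0 ≤ ν) :
    ∃ C : ℝ, 0 < C ∧ ∀ t p a x u : ℝ, 0 < t → 0 ≤ p → 0 < x → 0 < u → x - a = u * x →
      ∫ s in Ioi (0 : ℝ), localMajorant ν t p a x u s ≤
        C * (t / x ^ 2 * (t ^ 2 + u + p) ^ (-(ν + 2)) * exp (-(1 / 4000 * ((t ^ 2 + p) / u)))) := by
  set K := ((ν + 2) / (1 / 2000)) ^ (ν + 2) * exp (1 / 2000) with hK
  refine ⟨√(π * 1000) * K, by positivity, fun t p a x u ht hp hx hu hux => ?_⟩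
  have hd : 0 < x - a := by rw [hux]; positivity
  have h1 : ∫ s in Ioi (0 : ℝ), exp (-s) * exp (-(1 / (1000 * u) * (x * exp (-s) - a) ^ 2)) ≤
      x⁻¹ * (√(π * 1000) * √u) := by
    have h := integral_exp_neg_mul_gaussian_le (b := 1 / (1000 * u)) hx (by positivity) a
    simp_rw [mul_assoc] at h
    rw [integral_const_mul, mul_comm, ← le_div_iff₀ hx] at h
    refine h.trans_eq ?_
    rw [← sqrt_mul (by positivity), div_eq_inv_mul]
    congr 2
    field_simp
  set A := (t ^ 2 + p) / u with hA
  have hA0 : 0 ≤ A := by positivity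
  have h2 : u ^ (-(ν + 2)) ≤ K * exp (A / 2000) * (t ^ 2 + u + p) ^ (-(ν + 2)) := by
    have h3 := one_add_rpow_le_exp (b := ν + 2) (δ := 1 / 2000) (by positivity) (by norm_num) hA0
    have h4 : t ^ 2 + u + p = u * (1 + A) := by rw [hA]; field_simp; ring
    rw [h4, mul_rpow hu.le (by positivity), rpow_neg (by positivity : 0 ≤ 1 + A)]
    have h5 : 0 < (1 + A) ^ (ν + 2) := by positivity
    calc u ^ (-(ν + 2)) = (1 + A) ^ (ν + 2) * (u ^ (-(ν + 2)) * ((1 + A) ^ (ν + 2))⁻¹) := by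
          field_simp
      _ ≤ K * exp (1 / 2000 * A) * (u ^ (-(ν + 2)) * ((1 + A) ^ (ν + 2))⁻¹) := by gcongr
      _ = _ := by rw [one_div_mul_eq_div]
  have h6 : exp (-((t ^ 2 + p) / (1000 * u))) * exp (A / 2000) ≤ exp (-(1 / 4000 * A)) := by
    rw [← exp_add, exp_le_exp]
    have : (t ^ 2 + p) / (1000 * u) = A / 1000 := by rw [hA]; field_simp
    rw [this]; linarith
  have h7 : u ^ (-(ν + 3 / 2)) * √u * u⁻¹ = u ^ (-(ν + 2)) := by
    rw [sqrt_eq_rpow, ← rpow_neg_one, ← rpow_add hu, ← rpow_add hu]; congr 1; ring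
  unfold localMajorant
  rw [integral_const_mul]
  calc _ ≤ t * u ^ (-(ν + 3 / 2)) * exp (-((t ^ 2 + p) / (1000 * u))) / (x - a) *
        (x⁻¹ * (√(π * 1000) * √u)) := by gcongr
    _ = √(π * 1000) * (t / x ^ 2) * (u ^ (-(ν + 3 / 2)) * √u * u⁻¹) *
        exp (-((t ^ 2 + p) / (1000 * u))) := by
        rw [hux]; field_simp
    _ ≤ √(π * 1000) * (t / x ^ 2) * (K * exp (A / 2000) * (t ^ 2 + u + p) ^ (-(ν + 2))) *
        exp (-((t ^ 2 + p) / (1000 * u))) := by rw [h7]; gcongr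
    _ = √(π * 1000) * K * (t / x ^ 2) * (t ^ 2 + u + p) ^ (-(ν + 2)) *
        (exp (-((t ^ 2 + p) / (1000 * u))) * exp (A / 2000)) := by ring
    _ ≤ √(π * 1000) * K * (t / x ^ 2) * (t ^ 2 + u + p) ^ (-(ν + 2)) *
        exp (-(1 / 4000 * A)) := by gcongr
    _ = _ := by ring

lemma integrableOn_logMajorant {t p a x L : ℝ} (hx : 0 < x) :
    IntegrableOn (logMajorant t p a x L) (Ioi 0) :=
  (integrableOn_exp_neg_mul_gaussian hx (by norm_num) a).const_mul _

lemma integral_logMajorant_le {t p a x L : ℝ} (ht : 0 < t) (hp : 0 ≤ p) (ha : 0 < a) (hx : 0 < x)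
    (hL : 0 < L) :
    ∫ s in Ioi (0 : ℝ), logMajorant t p a x L s ≤
      √(π * 1000) * (t / (x * a) * L ^ (-(5 / 2) : ℝ) * exp (-(1 / 4000 * (t ^ 2 / L))) *
        exp (-(1 / 4000 * p))) := by
  have h := integral_exp_neg_mul_gaussian_le (b := 1 / 1000) hx (by norm_num) a
  rw [div_div_eq_mul_div, div_one] at h
  have h1 : exp (-(t ^ 2 / (1000 * L))) ≤ exp (-(1 / 4000 * (t ^ 2 / L))) := by
    rw [exp_le_exp]
    have : t ^ 2 / (1000 * L) = t ^ 2 / L / 1000 := by field_simp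
    have h2 : 0 ≤ t ^ 2 / L := by positivity
    rw [this]; linarith
  have h2 : exp (-(p / 1000)) ≤ exp (-(1 / 4000 * p)) := by rw [exp_le_exp]; linarith
  unfold logMajorant
  rw [integral_const_mul]
  calc _ ≤ t * L ^ (-(5 / 2) : ℝ) * exp (-(1 / 4000 * (t ^ 2 / L))) * exp (-(1 / 4000 * p)) /
        (x * a) * √(π * 1000) := by gcongr
    _ = _ := by ring

/-! ### Coordinates in `ℝⁿ` -/

section Coordinates

variable {n : ℕ} [NeZero n]

lemma perpSq_nonneg (y : EuclideanSpace ℝ (Fin n)) : 0 ≤ perpSq y :=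
  Finset.sum_nonneg fun _ _ => sq_nonneg _

lemma norm_sq_eq_add_perpSq (y : EuclideanSpace ℝ (Fin n)) :
    ‖y‖ ^ 2 = y 0 ^ 2 + perpSq y := by
  rw [EuclideanSpace.real_norm_sq_eq, perpSq]
  exact (Finset.add_sum_erase Finset.univ (fun i => y i ^ 2) (Finset.mem_univ 0)).symm

lemma e₁_apply_zero : e₁ n 0 = 1 := by simp [e₁]

lemma e₁_apply_of_ne {i : Fin n} (hi : i ≠ 0) : e₁ n i = 0 := by simp [e₁, hi]

lemma perpSq_sub_smul_e₁ (y : EuclideanSpace ℝ (Fin n)) (a : ℝ) :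
    perpSq (y - a • e₁ n) = perpSq y := by
  refine Finset.sum_congr rfl fun i hi => ?_
  simp [e₁_apply_of_ne (Finset.ne_of_mem_erase hi)]

lemma norm_sub_smul_e₁_sq (y : EuclideanSpace ℝ (Fin n)) (a : ℝ) :
    ‖y - a • e₁ n‖ ^ 2 = (y 0 - a) ^ 2 + perpSq y := by
  rw [norm_sq_eq_add_perpSq, perpSq_sub_smul_e₁]
  simp [e₁_apply_zero]

lemma norm_smul_e₁ {a : ℝ} (ha : 0 ≤ a) : ‖a • e₁ n‖ = a := by
  simp [e₁, norm_smul, abs_of_nonneg ha]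

lemma smul_e₁_apply_zero (a : ℝ) : (a • e₁ n) 0 = a := by simp [e₁_apply_zero]

end Coordinates

/-! ### The pointwise estimate -/

section Pointwise

lemma Z₁_nonneg {n : ℕ} {c t : ℝ} (ht : 0 < t) (x y : EuclideanSpace ℝ (Fin n)) : 0 ≤ Z₁ c t x y := by
  unfold Z₁; positivity

lemma Z₃_nonneg {n : ℕ} {c t : ℝ} (ht : 0 < t) (x y : EuclideanSpace ℝ (Fin n)) : 0 ≤ Z₃ c t x y := by
  unfold Z₃
  have : 0 < min t ((t ^ 2)⁻¹) := lt_min ht (by positivity)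
  positivity

variable {n : ℕ} [NeZero n]

lemma Z₂_nonneg {c t : ℝ} (ht : 0 < t) (x y : EuclideanSpace ℝ (Fin n)) : 0 ≤ Z₂ c t x y := by
  unfold Z₂
  split_ifs with h
  · have hx : 0 < x 0 := by linarith
    have hd : 0 < x 0 - y 0 := by linarith
    have := perpSq_nonneg y
    positivity
  · exact le_rfl

lemma Z₄_nonneg {c t : ℝ} (ht : 0 < t) (x y : EuclideanSpace ℝ (Fin n)) : 0 ≤ Z₄ c t x y := by
  unfold Z₄
  split_ifs with h
  · have hy : 0 < y 0 := by linarith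
    have hx : 0 < x 0 := by linarith
    have hL : 0 < log (x 0 / y 0) := log_pos (by rw [lt_div_iff₀ hy]; linarith)
    positivity
  · exact le_rfl

lemma integral_nearMajorant_eq_Z₁ {t x₁ : ℝ} (ht : 0 < t) (hx : 0 ≤ x₁)
    (y : EuclideanSpace ℝ (Fin n)) :
    ∫ s in Ioi (0 : ℝ), nearMajorant (n / 2) t ((x₁ - y 0) ^ 2 + perpSq y) x₁ s =
      Gamma ((n : ℝ) / 2 + 1) * 2000 ^ ((n : ℝ) / 2 + 1) * Z₁ (1 / 4000) t (x₁ • e₁ n) y := by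
  rw [integral_nearMajorant (by positivity) ht (add_nonneg (sq_nonneg _) (perpSq_nonneg y)), Z₁,
    norm_smul_e₁ hx, norm_sub_rev, norm_sub_smul_e₁_sq, sub_sq_comm,
    show ((n : ℝ) + 2) / 2 = n / 2 + 1 by ring]

/-- The estimate of the subordinated derivative by the four kernels. -/
lemma exists_abs_integral_dxIntegrand_le (n : ℕ) [NeZero n] :
    ∃ C : ℝ, 0 < C ∧ ∀ t x₁ : ℝ, 0 < t → 0 ≤ x₁ → ∀ y : EuclideanSpace ℝ (Fin n),
      |∫ s in Ioi (0 : ℝ), dxIntegrand (n / 2) t (perpSq y) (y 0) x₁ s| ≤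
        C * (Z₁ (1 / 4000) t (x₁ • e₁ n) y + Z₂ (1 / 4000) t (x₁ • e₁ n) y +
          Z₃ (1 / 4000) t (x₁ • e₁ n) y + Z₄ (1 / 4000) t (x₁ • e₁ n) y) := by
  have hν : (0 : ℝ) ≤ n / 2 := by positivity
  obtain ⟨C₁, hC₁, h₁⟩ := exists_abs_dxIntegrand_le hν
  obtain ⟨C₂, hC₂, h₂⟩ := exists_abs_partsIntegrand_le_of_le_one hν
  obtain ⟨C₃, hC₃, h₃⟩ := exists_abs_partsIntegrand_le_of_one_lt hν
  obtain ⟨C₄, hC₄, h₄⟩ := exists_abs_partsIntegrand_le_of_half_le hν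
  obtain ⟨K₂, hK₂, k₂⟩ := exists_integral_localMajorant_le hν
  obtain ⟨K₃, hK₃, k₃⟩ := exists_integral_farMajorant_le
  set K₁ := Gamma ((n : ℝ) / 2 + 1) * 2000 ^ ((n : ℝ) / 2 + 1) with hK₁
  have hK₁0 : 0 < K₁ := mul_pos (Gamma_pos_of_pos (by positivity)) (by positivity)
  set K₄ := √(π * 1000) with hK₄
  have hK₄0 : 0 < K₄ := by positivity
  refine ⟨(C₁ + C₂ + C₃ + C₄) * (K₁ + K₂ + K₃ + K₄), by positivity, fun t x₁ ht hx y => ?_⟩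
  have hp := perpSq_nonneg y
  have z₁ := Z₁_nonneg (c := 1 / 4000) ht (x₁ • e₁ n) y
  have z₂ := Z₂_nonneg (c := 1 / 4000) ht (x₁ • e₁ n) y
  have z₃ := Z₃_nonneg (c := 1 / 4000) ht (x₁ • e₁ n) y
  have z₄ := Z₄_nonneg (c := 1 / 4000) ht (x₁ • e₁ n) y
  set S := Z₁ (1 / 4000) t (x₁ • e₁ n) y + Z₂ (1 / 4000) t (x₁ • e₁ n) y +
    Z₃ (1 / 4000) t (x₁ • e₁ n) y + Z₄ (1 / 4000) t (x₁ • e₁ n) y with hS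
  have hw : 0 ≤ (x₁ - y 0) ^ 2 + perpSq y := by positivity
  have hNint := integrableOn_nearMajorant (x := x₁) hν ht hw
  have hFint := integrableOn_farMajorant (b := y 0 ^ 2 + perpSq y) (x := x₁) ht
  have hN := integral_nearMajorant_eq_Z₁ ht hx y
  have hF : ∫ s in Ioi (0 : ℝ), farMajorant t (y 0 ^ 2 + perpSq y) x₁ s ≤
      K₃ * Z₃ (1 / 4000) t (x₁ • e₁ n) y := by
    rw [Z₃, norm_smul_e₁ hx, norm_sq_eq_add_perpSq]
    exact k₃ t _ x₁ ht (by positivity) hx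
  have hNF : ∫ s in Ioi (0 : ℝ), (nearMajorant (n / 2) t ((x₁ - y 0) ^ 2 + perpSq y) x₁ s +
      farMajorant t (y 0 ^ 2 + perpSq y) x₁ s) ≤
        K₁ * Z₁ (1 / 4000) t (x₁ • e₁ n) y + K₃ * Z₃ (1 / 4000) t (x₁ • e₁ n) y := by
    rw [integral_add hNint hFint, hN]
    gcongr
  have bound : ∀ (C : ℝ) (f g : ℝ → ℝ), 0 ≤ C → C ≤ C₁ + C₂ + C₃ + C₄ →
      IntegrableOn g (Ioi 0) → (∀ s, 0 < s → |f s| ≤ C * g s) →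
      ∫ s in Ioi (0 : ℝ), g s ≤ (K₁ + K₂ + K₃ + K₄) * S →
      |∫ s in Ioi (0 : ℝ), f s| ≤ (C₁ + C₂ + C₃ + C₄) * (K₁ + K₂ + K₃ + K₄) * S := by
    intro C f g hC hC' hg hfg hgS
    have h := norm_integral_le_of_norm_le (f := f) (hg.const_mul C)
      ((ae_restrict_iff' measurableSet_Ioi).2 (ae_of_all _ fun s hs => hfg s hs))
    rw [integral_const_mul] at h
    refine h.trans ?_
    have hS0 : 0 ≤ S := by positivity
    calc _ ≤ C * ((K₁ + K₂ + K₃ + K₄) * S) := by gcongr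
      _ ≤ (C₁ + C₂ + C₃ + C₄) * ((K₁ + K₂ + K₃ + K₄) * S) := by gcongr
      _ = _ := by ring
  -- Each regime takes coefficient 0 for the kernels it does not need.
  have dist : ∀ i j k l : ℝ, 0 ≤ i → i ≤ K₁ → 0 ≤ j → j ≤ K₂ → 0 ≤ k → k ≤ K₃ → 0 ≤ l → l ≤ K₄ →
      i * Z₁ (1 / 4000) t (x₁ • e₁ n) y + j * Z₂ (1 / 4000) t (x₁ • e₁ n) y +
        k * Z₃ (1 / 4000) t (x₁ • e₁ n) y + l * Z₄ (1 / 4000) t (x₁ • e₁ n) y ≤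
        (K₁ + K₂ + K₃ + K₄) * S := by
    intro i j k l _ hi _ hj _ hk _ hl
    rw [hS, mul_add, mul_add, mul_add]
    gcongr <;> linarith
  have hNFS := dist K₁ 0 K₃ 0 hK₁0.le le_rfl le_rfl hK₂.le hK₃.le le_rfl le_rfl hK₄0.le
  rw [zero_mul, zero_mul, add_zero, add_zero] at hNFS
  by_cases hcase : x₁ ≤ 1 ∨ (x₁ / 2 ≤ y 0 ∧ x₁ * (x₁ - y 0) ≤ 1)
  · exact bound C₁ _ _ hC₁.le (by linarith) (hNint.add hFint)
      (fun s hs => h₁ t _ _ x₁ s ht hp hx hs hcase) (hNF.trans hNFS)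
  rw [not_or, not_and_or, not_le, not_le, not_le] at hcase
  obtain ⟨hx1, hcase⟩ := hcase
  have hx0 : 0 < x₁ := by linarith
  rcases lt_or_ge (y 0) (x₁ / 2) with ha | ha
  · rw [integral_dxIntegrand_eq_integral_partsIntegrand hν ht hp hx1.le (by linarith)]
    rcases le_or_gt (y 0) 1 with ha1 | ha1
    · exact bound C₂ _ _ hC₂.le (by linarith) (hNint.add hFint)
        (fun s hs => h₂ t _ _ x₁ s ht hp hx1.le hs ha ha1) (hNF.trans hNFS)
    · have hy0 : 0 < y 0 := by linarith
      have hL : 0 < log (x₁ / y 0) := log_pos (by rw [lt_div_iff₀ hy0]; linarith)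
      have hLint := integrableOn_logMajorant (t := t) (p := perpSq y) (a := y 0)
        (L := log (x₁ / y 0)) hx0
      refine bound C₃ _ _ hC₃.le (by linarith) ((hNint.add hFint).add hLint)
        (fun s hs => h₃ t _ _ x₁ s ht hp hx1.le hs ha ha1) ?_
      have h5 := integral_logMajorant_le ht hp hy0 hx0 hL
      have h6 : Z₄ (1 / 4000) t (x₁ • e₁ n) y = t / (x₁ * y 0) * log (x₁ / y 0) ^ (-(5 / 2) : ℝ) *
          exp (-(1 / 4000 * (t ^ 2 / log (x₁ / y 0)))) * exp (-(1 / 4000 * perpSq y)) := by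
        rw [Z₄, smul_e₁_apply_zero, if_pos ⟨ha1, ha⟩]
      rw [← h6] at h5
      have h7 := dist K₁ 0 K₃ K₄ hK₁0.le le_rfl le_rfl hK₂.le hK₃.le le_rfl hK₄0.le le_rfl
      refine le_trans ?_ h7
      rw [zero_mul, add_zero]
      refine (integral_add (hNint.add hFint) hLint).trans_le ?_
      exact add_le_add hNF h5
  · have hxa : 1 < x₁ * (x₁ - y 0) := by
      rcases hcase with h | h
      · exact absurd ha h.not_ge
      · exact h
    have hd : 0 < x₁ - y 0 := pos_of_mul_pos_right (by linarith) hx0.le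
    rw [integral_dxIntegrand_eq_integral_partsIntegrand hν ht hp hx1.le (by linarith)]
    have hu : 0 < (x₁ - y 0) / x₁ := by positivity
    have hux : x₁ - y 0 = (x₁ - y 0) / x₁ * x₁ := by field_simp
    have hLint := integrableOn_localMajorant (ν := n / 2) (t := t) (p := perpSq y) (a := y 0)
      hx0 hu
    refine bound C₄ _ _ hC₄.le (by linarith) ((hNint.add hFint).add hLint)
      (fun s hs => h₄ t _ _ x₁ _ s ht hp hx1.le hs ha (by linarith) hxa.le hux) ?_
    have h5 := k₂ t (perpSq y) (y 0) x₁ _ ht hp hx0 hu hux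
    have h6 : Z₂ (1 / 4000) t (x₁ • e₁ n) y = t / x₁ ^ 2 *
        (t ^ 2 + (x₁ - y 0) / x₁ + perpSq y) ^ (-((n : ℝ) / 2 + 2)) *
          exp (-(1 / 4000 * ((t ^ 2 + perpSq y) / ((x₁ - y 0) / x₁)))) := by
      rw [Z₂, smul_e₁_apply_zero, if_pos ⟨hx1, ha, by linarith⟩, div_div_eq_mul_div,
        show ((n : ℝ) + 4) / 2 = n / 2 + 2 by ring]
    rw [← h6] at h5
    have h7 := dist K₁ K₂ K₃ 0 hK₁0.le le_rfl hK₂.le le_rfl hK₃.le le_rfl le_rfl hK₄0.le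
    refine ((integral_add (hNint.add hFint) hLint).trans_le (add_le_add hNF h5)).trans ?_
    linarith

end Pointwise

/-! ### Differentiation under the integral sign -/

section Derivative

variable {n : ℕ} [NeZero n]

lemma poissonIntegrand_smul_e₁ (t z s : ℝ) (y : EuclideanSpace ℝ (Fin n)) :
    poissonIntegrand t (z • e₁ n) y s = t / s ^ (3 / 2 : ℝ) * exp (-(t ^ 2 / (4 * s))) *
      (exp (-(((y 0 - exp (-s) * z) ^ 2 + perpSq y) / (1 - exp (-s) ^ 2))) /
        (1 - exp (-s) ^ 2) ^ ((n : ℝ) / 2)) := by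
  rw [poissonIntegrand, mehlerKernel, smul_smul, norm_sub_smul_e₁_sq]

lemma hasDerivAt_poissonIntegrand (t z s : ℝ) (y : EuclideanSpace ℝ (Fin n)) :
    HasDerivAt (fun z => poissonIntegrand t (z • e₁ n) y s)
      (dxIntegrand (n / 2) t (perpSq y) (y 0) z s) z := by
  simp_rw [poissonIntegrand_smul_e₁]
  have h := (((((((hasDerivAt_id z).const_mul (exp (-s))).const_sub (y 0)).pow 2).add_const
    (perpSq y)).div_const (1 - exp (-s) ^ 2)).neg.exp.div_const
      ((1 - exp (-s) ^ 2) ^ ((n : ℝ) / 2))).const_mul (t / s ^ (3 / 2 : ℝ) *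
        exp (-(t ^ 2 / (4 * s))))
  refine h.congr_deriv ?_
  rw [dxIntegrand]
  simp only [id, Pi.neg_apply, Pi.pow_apply, Nat.cast_ofNat, Nat.add_one_sub_one, pow_one, mul_one]
  ring

lemma measurable_poissonIntegrand (t z : ℝ) (y : EuclideanSpace ℝ (Fin n)) :
    Measurable (poissonIntegrand t (z • e₁ n) y) := by
  unfold poissonIntegrand mehlerKernel; fun_prop

lemma integrableOn_poissonIntegrand {t : ℝ} (ht : 0 < t) (z : ℝ) (y : EuclideanSpace ℝ (Fin n)) :
    IntegrableOn (poissonIntegrand t (z • e₁ n) y) (Ioi 0) := by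
  have hν : (0 : ℝ) ≤ n / 2 := by positivity
  refine ((integrableOn_dominator hν ht).const_mul t).mono'
    (measurable_poissonIntegrand t z y).aestronglyMeasurable ?_
  filter_upwards [ae_restrict_mem measurableSet_Ioi] with s hs
  have hs0 : 0 < s := hs
  have hm := one_sub_exp_neg_sq_pos hs0
  have hp := perpSq_nonneg y
  have h2 := rpow_mul_exp_le_dominator (b := n / 2) (t := t)
    (E := t ^ 2 / (4 * s) + ((y 0 - exp (-s) * z) ^ 2 + perpSq y) / (1 - exp (-s) ^ 2)) hν hs0 (by
      have : t ^ 2 / (8 * s) ≤ t ^ 2 / (4 * s) := by gcongr; norm_num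
      have h3 : 0 ≤ ((y 0 - exp (-s) * z) ^ 2 + perpSq y) / (1 - exp (-s) ^ 2) := by positivity
      linarith)
  rw [poissonIntegrand_smul_e₁, Real.norm_of_nonneg (by positivity)]
  calc _ = t * (s ^ (-(3 / 2) : ℝ) * (1 - exp (-s) ^ 2) ^ (-((n : ℝ) / 2)) *
        exp (-(t ^ 2 / (4 * s) +
          ((y 0 - exp (-s) * z) ^ 2 + perpSq y) / (1 - exp (-s) ^ 2)))) := by
        rw [neg_add, exp_add, rpow_neg hs0.le, rpow_neg hm.le]
        simp only [div_eq_mul_inv]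
        ring
    _ ≤ _ := by gcongr

lemma hasDerivAt_poissonKernel {t : ℝ} (ht : 0 < t) (x₁ : ℝ) (y : EuclideanSpace ℝ (Fin n)) :
    HasDerivAt (fun z => poissonKernel t (z • e₁ n) y)
      (1 / (2 * π ^ (((n : ℝ) + 1) / 2)) *
        ∫ s in Ioi (0 : ℝ), dxIntegrand (n / 2) t (perpSq y) (y 0) x₁ s) x₁ := by
  have hν : (0 : ℝ) ≤ n / 2 := by positivity
  have h := (hasDerivAt_integral_of_dominated_loc_of_deriv_le (μ := volume.restrict (Ioi 0))
    (F := fun z s => poissonIntegrand t (z • e₁ n) y s)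
    (F' := fun z s => dxIntegrand (n / 2) t (perpSq y) (y 0) z s)
    (bound := fun s => 2 * (t * dominator (n / 2 + 1 / 2) t s)) (x₀ := x₁) (s := univ) univ_mem
    (Eventually.of_forall fun z => (measurable_poissonIntegrand t z y).aestronglyMeasurable)
    (integrableOn_poissonIntegrand ht x₁ y)
    (measurable_dxIntegrand _ _ _ _ _).aestronglyMeasurable
    ((ae_restrict_iff' measurableSet_Ioi).2 (ae_of_all _ fun s hs z _ =>
      abs_dxIntegrand_le_dominator hν ht (perpSq_nonneg y) hs))
    (((integrableOn_dominator (by positivity) ht).const_mul t).const_mul 2)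
    (ae_of_all _ fun s z _ => hasDerivAt_poissonIntegrand t z s y)).2
  exact h.const_mul _

lemma hasLineDerivAt_poissonKernel {t : ℝ} (ht : 0 < t) (x₁ : ℝ) (y : EuclideanSpace ℝ (Fin n)) :
    HasLineDerivAt ℝ (fun z => poissonKernel t z y)
      (1 / (2 * π ^ (((n : ℝ) + 1) / 2)) *
        ∫ s in Ioi (0 : ℝ), dxIntegrand (n / 2) t (perpSq y) (y 0) x₁ s) (x₁ • e₁ n) (e₁ n) := by
  have h := hasDerivAt_poissonKernel ht x₁ y
  rw [← add_zero x₁] at h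
  have h' := h.comp_const_add x₁ 0
  rw [add_zero] at h'
  unfold HasLineDerivAt
  simpa only [add_smul] using h'

lemma dx₁PoissonKernel_eq {t : ℝ} (ht : 0 < t) (x₁ : ℝ) (y : EuclideanSpace ℝ (Fin n)) :
    dx₁PoissonKernel t (x₁ • e₁ n) y = 1 / (2 * π ^ (((n : ℝ) + 1) / 2)) *
        ∫ s in Ioi (0 : ℝ), dxIntegrand (n / 2) t (perpSq y) (y 0) x₁ s :=
  (hasLineDerivAt_poissonKernel ht x₁ y).lineDeriv

lemma measurable_perpSq : Measurable (perpSq : EuclideanSpace ℝ (Fin n) → ℝ) := by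
  unfold perpSq; fun_prop

lemma stronglyMeasurable_dx₁PoissonKernel {t : ℝ} (ht : 0 < t) (x₁ : ℝ) :
    StronglyMeasurable fun y : EuclideanSpace ℝ (Fin n) => dx₁PoissonKernel t (x₁ • e₁ n) y := by
  simp_rw [dx₁PoissonKernel_eq ht]
  refine StronglyMeasurable.const_mul ?_ _
  refine StronglyMeasurable.integral_prod_right
    (f := fun (y : EuclideanSpace ℝ (Fin n)) s => dxIntegrand (n / 2) t (perpSq y) (y 0) x₁ s) ?_
  apply Measurable.stronglyMeasurable
  unfold Function.uncurry dxIntegrand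
  have := measurable_perpSq (n := n)
  fun_prop

end Derivative

/-! ### Integrals over `ℝⁿ` -/

lemma lintegral_exp_neg_mul_sum_sq {m : ℕ} {b : ℝ} (hb : 0 < b) :
    ∫⁻ v : Fin m → ℝ, ENNReal.ofReal (exp (-(b * ∑ i, v i ^ 2))) =
      ENNReal.ofReal (√(π / b) ^ m) := by
  have h : ∀ v : Fin m → ℝ, exp (-(b * ∑ i, v i ^ 2)) = ∏ i, exp (-b * v i ^ 2) := by
    intro v
    rw [← exp_sum, Finset.mul_sum, ← Finset.sum_neg_distrib]
    simp
  have hi : Integrable fun v : Fin m → ℝ => ∏ i, exp (-b * v i ^ 2) :=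
    Integrable.fintype_prod fun _ => integrable_exp_neg_mul_sq hb
  simp_rw [h]
  rw [← ofReal_integral_eq_lintegral_ofReal hi
    (ae_of_all _ fun v => Finset.prod_nonneg fun i _ => (exp_pos _).le),
    integral_fintype_prod_volume_eq_pow fun w : ℝ => exp (-b * w ^ 2), integral_gaussian,
    Fintype.card_fin]

/-- Tonelli in y = (y₁, y') and the Gaussian integral in the n - 1 variables y'. Positivity of B is
needed only where A ≠ 0, because for Z₂ the rate is positive only for y₁ < x₁. -/
lemma lintegral_mul_exp_neg_perpSq {n : ℕ} [NeZero n] {A B : ℝ → ℝ} (hA : Measurable A)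
    (hB : Measurable B) (hA0 : ∀ w, 0 ≤ A w) (hAB : ∀ w, A w ≠ 0 → 0 < B w) :
    ∫⁻ y : EuclideanSpace ℝ (Fin n), ENNReal.ofReal (A (y 0) * exp (-(B (y 0) * perpSq y))) =
      ∫⁻ w, ENNReal.ofReal (A w * √(π / B w) ^ (n - 1)) := by
  obtain ⟨m, rfl⟩ : ∃ m, n = m + 1 := Nat.exists_eq_succ_of_ne_zero (NeZero.ne n)
  rw [Nat.add_sub_cancel]
  have hφ := (volume_preserving_piFinSuccAbove (fun _ : Fin (m + 1) => ℝ) 0).comp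
    (PiLp.volume_preserving_ofLp (Fin (m + 1)))
  let g : ℝ × (Fin m → ℝ) → ENNReal := fun q =>
    ENNReal.ofReal (A q.1 * exp (-(B q.1 * ∑ i, q.2 i ^ 2)))
  have hg : Measurable g := by fun_prop
  have h1 : ∀ y : EuclideanSpace ℝ (Fin (m + 1)),
      ENNReal.ofReal (A (y 0) * exp (-(B (y 0) * perpSq y))) =
        g ((MeasurableEquiv.piFinSuccAbove (fun _ : Fin (m + 1) => ℝ) 0 ∘ WithLp.ofLp) y) := by
    intro y
    have h2 : perpSq y = ∑ i : Fin m, y i.succ ^ 2 := by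
      have h3 := norm_sq_eq_add_perpSq y
      rw [EuclideanSpace.real_norm_sq_eq, Fin.sum_univ_succ] at h3
      exact (add_left_cancel h3).symm
    rw [h2]
    rfl
  simp_rw [h1]
  rw [hφ.lintegral_comp hg, Measure.volume_eq_prod, lintegral_prod _ hg.aemeasurable]
  refine lintegral_congr fun w => ?_
  simp only [g]
  rcases eq_or_ne (A w) 0 with h | h
  · simp [h]
  · simp_rw [ENNReal.ofReal_mul (hA0 w)]
    rw [lintegral_const_mul _ (by fun_prop), lintegral_exp_neg_mul_sum_sq (hAB w h)]

lemma integrable_mul_exp_neg_perpSq {n : ℕ} [NeZero n] {A B : ℝ → ℝ} (hA : Measurable A)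
    (hB : Measurable B) (hA0 : ∀ w, 0 ≤ A w) (hAB : ∀ w, A w ≠ 0 → 0 < B w)
    (hint : Integrable fun w => A w * √(π / B w) ^ (n - 1)) :
    Integrable (fun y : EuclideanSpace ℝ (Fin n) => A (y 0) * exp (-(B (y 0) * perpSq y))) ∧
      ∫ y : EuclideanSpace ℝ (Fin n), A (y 0) * exp (-(B (y 0) * perpSq y)) =
        ∫ w, A w * √(π / B w) ^ (n - 1) := by
  have h := lintegral_mul_exp_neg_perpSq (n := n) hA hB hA0 hAB
  have hm : Measurable fun y : EuclideanSpace ℝ (Fin n) =>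
      A (y 0) * exp (-(B (y 0) * perpSq y)) := by
    have := measurable_perpSq (n := n)
    fun_prop
  have h0 : ∀ y : EuclideanSpace ℝ (Fin n), 0 ≤ A (y 0) * exp (-(B (y 0) * perpSq y)) :=
    fun y => mul_nonneg (hA0 _) (exp_pos _).le
  have h0' : ∀ w, 0 ≤ A w * √(π / B w) ^ (n - 1) := fun w => mul_nonneg (hA0 _) (by positivity)
  constructor
  · refine ⟨hm.aestronglyMeasurable, ?_⟩
    rw [hasFiniteIntegral_iff_ofReal (ae_of_all _ h0), h]
    exact (hasFiniteIntegral_iff_ofReal (ae_of_all _ h0')).1 hint.2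
  · rw [integral_eq_lintegral_of_nonneg_ae (ae_of_all _ h0) hm.aestronglyMeasurable, h,
      integral_eq_lintegral_of_nonneg_ae (ae_of_all _ h0') hint.1]

lemma inv_le_two_mul_inv_one_add {x : ℝ} (hx : 1 < x) : x⁻¹ ≤ 2 * (1 + x)⁻¹ := by
  rw [← div_eq_mul_inv, le_div_iff₀ (by linarith), inv_mul_le_iff₀ (by linarith)]
  linarith

lemma mul_sq_rpow_neg_three_halves {c t : ℝ} (hc : 0 < c) (ht : 0 < t) :
    (c * t ^ 2) ^ (-(3 / 2) : ℝ) = c ^ (-(3 / 2) : ℝ) * (t ^ 3)⁻¹ := by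
  rw [mul_rpow hc.le (by positivity), ← rpow_natCast t 2, ← rpow_mul ht.le, ← rpow_natCast t 3,
    ← rpow_neg ht.le]
  norm_num

/-! ### L¹ bounds for the four kernels. -/

section Majorants

variable (n : ℕ) [NeZero n]

/-- Scaling by t gives t · t^{-(n+2)} · tⁿ = t⁻¹, and e^{-ct(1+x₁)} ≤ 1/(ct(1 + x₁)) gives the rest.
-/
lemma exists_integrable_Z₁ {c : ℝ} (hc : 0 < c) :
    ∃ K : ℝ, 0 ≤ K ∧ ∀ t x₁ : ℝ, 0 < t → 0 ≤ x₁ →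
      Integrable (fun y : EuclideanSpace ℝ (Fin n) => Z₁ c t (x₁ • e₁ n) y) ∧
      ∫ y : EuclideanSpace ℝ (Fin n), Z₁ c t (x₁ • e₁ n) y ≤ K * ((t ^ 2)⁻¹ * (1 + x₁)⁻¹) := by
  let J : EuclideanSpace ℝ (Fin n) → ℝ := fun z => (1 + ‖z‖ ^ 2) ^ (-((n : ℝ) + 2) / 2)
  have hJ : Integrable J := integrable_rpow_neg_one_add_norm_sq (by simp)
  have hJ0 : 0 ≤ ∫ z, J z := integral_nonneg fun z => by positivity
  refine ⟨(∫ z, J z) * c⁻¹, by positivity, fun t x₁ ht hx => ?_⟩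
  set E := exp (-(c * (t * (1 + x₁)))) with hE
  have hE1 : E ≤ (c * (t * (1 + x₁)))⁻¹ := exp_neg_le_inv (by positivity)
  have h1 : ∀ y : EuclideanSpace ℝ (Fin n), Z₁ c t (x₁ • e₁ n) y =
      t * (t ^ (n + 2))⁻¹ * E * J (t⁻¹ • (x₁ • e₁ n - y)) := by
    intro y
    have h2 : t ^ 2 + ‖x₁ • e₁ n - y‖ ^ 2 =
        t ^ 2 * (1 + ‖t⁻¹ • (x₁ • e₁ n - y)‖ ^ 2) := by
      rw [norm_smul, norm_of_nonneg (by positivity : 0 ≤ t⁻¹)]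
      field_simp
    have h3 : (t ^ 2) ^ (((n : ℝ) + 2) / 2) = t ^ (n + 2) := by
      rw [← rpow_natCast t 2, ← rpow_mul ht.le, ← rpow_natCast]
      congr 1
      push_cast
      ring
    simp only [Z₁, J]
    rw [norm_smul_e₁ hx, h2, mul_rpow (by positivity) (by positivity), h3, neg_div,
      rpow_neg (by positivity), hE]
    simp only [div_eq_mul_inv, mul_inv]
    ring
  simp_rw [h1]
  have hJt : Integrable fun y : EuclideanSpace ℝ (Fin n) => J (t⁻¹ • (x₁ • e₁ n - y)) :=
    (hJ.comp_smul (inv_ne_zero ht.ne')).comp_sub_left (x₁ • e₁ n)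
  refine ⟨hJt.const_mul _, ?_⟩
  rw [integral_const_mul, integral_sub_left_eq_self
    (fun z : EuclideanSpace ℝ (Fin n) => J (t⁻¹ • z)), Measure.integral_comp_smul, smul_eq_mul,
    finrank_euclideanSpace_fin, inv_pow, inv_inv, abs_of_pos (by positivity)]
  calc _ ≤ t * (t ^ (n + 2))⁻¹ * (c * (t * (1 + x₁)))⁻¹ * (t ^ n * ∫ z, J z) := by gcongr
    _ = _ := by
      rw [pow_add]
      field_simp

lemma exists_majorant_Z₃ {c : ℝ} (hc : 0 < c) :
    ∃ K : ℝ, 0 ≤ K ∧ ∀ t x₁ : ℝ, 0 < t → 0 ≤ x₁ →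
      ∃ M : EuclideanSpace ℝ (Fin n) → ℝ, (∀ y, Z₃ c t (x₁ • e₁ n) y ≤ M y) ∧ Integrable M ∧
        ∫ y, M y ≤ K * ((t ^ 2)⁻¹ * (1 + x₁)⁻¹) := by
  refine ⟨√(π / c) * √(π / c) ^ (n - 1), by positivity, fun t x₁ ht hx => ?_⟩
  have hint : Integrable fun w : ℝ => (t ^ 2)⁻¹ * (1 + x₁)⁻¹ * exp (-c * w ^ 2) *
      √(π / c) ^ (n - 1) := ((integrable_exp_neg_mul_sq hc).const_mul _).mul_const _
  obtain ⟨h1, h2⟩ := integrable_mul_exp_neg_perpSq (n := n)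
    (A := fun w => (t ^ 2)⁻¹ * (1 + x₁)⁻¹ * exp (-c * w ^ 2)) (B := fun _ => c) (by fun_prop)
    (by fun_prop) (fun w => by positivity) (fun _ _ => hc) hint
  refine ⟨_, fun y => ?_, h1, ?_⟩
  · rw [Z₃, norm_smul_e₁ hx, norm_sq_eq_add_perpSq, mul_add, neg_add, exp_add, ← mul_assoc,
      div_eq_mul_inv, neg_mul]
    gcongr
    exact min_le_right _ _
  · rw [h2, integral_mul_const, integral_const_mul, integral_gaussian]
    exact le_of_eq (by ring)

lemma exists_majorant_Z₄ {c : ℝ} (hc : 0 < c) :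
    ∃ K : ℝ, 0 ≤ K ∧ ∀ t x₁ : ℝ, 0 < t → 0 ≤ x₁ →
      ∃ M : EuclideanSpace ℝ (Fin n) → ℝ, (∀ y, Z₄ c t (x₁ • e₁ n) y ≤ M y) ∧ Integrable M ∧
        ∫ y, M y ≤ K * ((t ^ 2)⁻¹ * (1 + x₁)⁻¹) := by
  have hΓ : 0 < Gamma (3 / 2) := Gamma_pos_of_pos (by norm_num)
  refine ⟨2 * Gamma (3 / 2) * c ^ (-(3 / 2) : ℝ) * √(π / c) ^ (n - 1), by positivity,
    fun t x₁ ht hx => ?_⟩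
  rcases le_or_gt x₁ 1 with hx1 | hx1
  · refine ⟨0, fun y => ?_, integrable_zero _ _ _, ?_⟩
    · rw [Z₄, smul_e₁_apply_zero, if_neg (fun h => by linarith [h.1, h.2])]
      exact le_rfl
    · simp only [Pi.zero_apply, integral_zero]
      positivity
  have hx0 : 0 < x₁ := by linarith
  let g : ℝ → ℝ := fun w => t / (x₁ * w) * log (x₁ / w) ^ (-(5 / 2) : ℝ) *
    exp (-(c * (t ^ 2 / log (x₁ / w))))
  -- With w = x₁ e^{-s} the logarithm log(x₁/w) is s itself and the Jacobian cancels the factor 1/w.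
  have hgs : ∀ s : ℝ, x₁ * exp (-s) * g (x₁ * exp (-s)) =
      t * x₁⁻¹ * (s ^ (-(3 / 2 + 1) : ℝ) * exp (-(c * t ^ 2 / s))) := by
    intro s
    have h1 : log (x₁ / (x₁ * exp (-s))) = s := by
      rw [div_mul_cancel_left₀ hx0.ne', ← exp_neg, neg_neg, log_exp]
    simp only [g]
    rw [h1, show (-(5 / 2) : ℝ) = -(3 / 2 + 1) by norm_num, ← mul_div_assoc c]
    field_simp
  have hI := integrableOn_rpow_mul_exp_neg_div (b := 3 / 2) (A := c * t ^ 2) (by norm_num)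
    (by positivity)
  have hgint : IntegrableOn g (Ioo 0 x₁) := by
    rw [← integrableOn_mul_exp_neg_comp hx0]
    simp_rw [hgs]
    exact hI.const_mul _
  have hgval : ∫ w in Ioo 0 x₁, g w = t * x₁⁻¹ *
      (Gamma (3 / 2) * (c ^ (-(3 / 2) : ℝ) * (t ^ 3)⁻¹)) := by
    rw [← integral_mul_exp_neg_comp hx0]
    simp_rw [hgs]
    rw [integral_const_mul, integral_rpow_mul_exp_neg_div (by norm_num) (by positivity),
      mul_sq_rpow_neg_three_halves hc ht]
  have hgm : Measurable g := by fun_prop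
  have hg0 : ∀ w, 0 ≤ (Ioo 0 x₁).indicator g w := by
    refine fun w => indicator_nonneg (fun w hw => ?_) w
    have hw0 : 0 < w := hw.1
    have hL : 0 < log (x₁ / w) := log_pos ((one_lt_div hw0).2 hw.2)
    positivity
  obtain ⟨h1, h2⟩ := integrable_mul_exp_neg_perpSq (n := n)
    (A := (Ioo 0 x₁).indicator g) (B := fun _ => c) (hgm.indicator measurableSet_Ioo)
    (by fun_prop) hg0 (fun _ _ => hc) ((hgint.integrable_indicator measurableSet_Ioo).mul_const _)
  refine ⟨_, fun y => ?_, h1, ?_⟩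
  · rw [Z₄, smul_e₁_apply_zero]
    split_ifs with h
    · rw [indicator_of_mem (show y 0 ∈ Ioo 0 x₁ from ⟨by linarith [h.1], by linarith [h.2]⟩)]
    · exact mul_nonneg (hg0 _) (exp_pos _).le
  · rw [h2, integral_mul_const, integral_indicator measurableSet_Ioo, hgval]
    calc _ = Gamma (3 / 2) * c ^ (-(3 / 2) : ℝ) * √(π / c) ^ (n - 1) * (t ^ 2)⁻¹ * x₁⁻¹ := by
          field_simp
      _ ≤ Gamma (3 / 2) * c ^ (-(3 / 2) : ℝ) * √(π / c) ^ (n - 1) * (t ^ 2)⁻¹ *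
          (2 * (1 + x₁)⁻¹) := by
          gcongr
          exact inv_le_two_mul_inv_one_add hx1
      _ = _ := by ring

lemma exists_majorant_Z₂ {c : ℝ} (hc : 0 < c) :
    ∃ K : ℝ, 0 ≤ K ∧ ∀ t x₁ : ℝ, 0 < t → 0 ≤ x₁ →
      ∃ M : EuclideanSpace ℝ (Fin n) → ℝ, (∀ y, Z₂ c t (x₁ • e₁ n) y ≤ M y) ∧ Integrable M ∧
        ∫ y, M y ≤ K * ((t ^ 2)⁻¹ * (1 + x₁)⁻¹) := by
  have hΓ : 0 < Gamma (3 / 2) := Gamma_pos_of_pos (by norm_num)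
  refine ⟨2 * Gamma (3 / 2) * c ^ (-(3 / 2) : ℝ) * √(π / c) ^ (n - 1), by positivity,
    fun t x₁ ht hx => ?_⟩
  rcases le_or_gt x₁ 1 with hx1 | hx1
  · refine ⟨0, fun y => ?_, integrable_zero _ _ _, ?_⟩
    · rw [Z₂, smul_e₁_apply_zero, if_neg (fun h => by linarith [h.1])]
      exact le_rfl
    · simp only [Pi.zero_apply, integral_zero]
      positivity
  have hx0 : 0 < x₁ := by linarith
  let A : ℝ → ℝ := (Iio x₁).indicator fun w => t / x₁ ^ 2 *
    ((x₁ - w) / x₁) ^ (-((n : ℝ) / 2 + 2)) * exp (-(c * t ^ 2 / ((x₁ - w) / x₁)))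
  let B : ℝ → ℝ := fun w => c / ((x₁ - w) / x₁)
  let H : ℝ → ℝ := (Ioi 0).indicator fun u => t / x₁ ^ 2 * √(π / c) ^ (n - 1) *
    (u ^ (-(3 / 2 + 1) : ℝ) * exp (-(c * t ^ 2 / u)))
  have hI := integrableOn_rpow_mul_exp_neg_div (b := 3 / 2) (A := c * t ^ 2) (by norm_num)
    (by positivity)
  have hH : Integrable H := (integrable_indicator_iff measurableSet_Ioi).2 (hI.const_mul _)
  have hHval : ∫ u, H u = t / x₁ ^ 2 * √(π / c) ^ (n - 1) *
      (Gamma (3 / 2) * (c ^ (-(3 / 2) : ℝ) * (t ^ 3)⁻¹)) := by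
    rw [integral_indicator measurableSet_Ioi, integral_const_mul,
      integral_rpow_mul_exp_neg_div (by norm_num) (by positivity),
      mul_sq_rpow_neg_three_halves hc ht]
  -- The y'-integral contributes u^{(n-1)/2}, and -(n/2 + 2) + (n - 1)/2 = -5/2 whatever n is.
  have hAB : ∀ w, A w * √(π / B w) ^ (n - 1) = H ((x₁ - w) / x₁) := by
    intro w
    by_cases hw : w < x₁
    · have hu : 0 < (x₁ - w) / x₁ := div_pos (by linarith) hx0
      simp only [A, B, H]
      rw [indicator_of_mem (by exact hw), indicator_of_mem (by exact hu)]
      generalize (x₁ - w) / x₁ = u at hu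
      have hn : ((n - 1 : ℕ) : ℝ) = n - 1 := by
        rw [Nat.cast_pred (Nat.pos_of_ne_zero (NeZero.ne n))]
      have h1 : √(π / (c / u)) ^ (n - 1) = √(π / c) ^ (n - 1) * u ^ (((n : ℝ) - 1) / 2) := by
        rw [div_div_eq_mul_div, mul_comm π, mul_div_assoc, sqrt_mul hu.le, mul_pow, mul_comm,
          sqrt_eq_rpow u, ← rpow_natCast (u ^ (1 / 2 : ℝ)), ← rpow_mul hu.le, hn]
        congr 2
        ring
      have h2 : u ^ (-(3 / 2 + 1) : ℝ) = u ^ (-((n : ℝ) / 2 + 2)) * u ^ (((n : ℝ) - 1) / 2) := by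
        rw [← rpow_add hu]; congr 1; ring
      rw [h1, h2]
      ring
    · have hu : (x₁ - w) / x₁ ≤ 0 := div_nonpos_of_nonpos_of_nonneg (by linarith) hx0.le
      simp only [A, H]
      rw [indicator_of_notMem (by exact hw), indicator_of_notMem (by simpa using hu), zero_mul]
  have hA0 : ∀ w, 0 ≤ A w := by
    refine fun w => indicator_nonneg (fun w hw => ?_) w
    have hu : 0 < (x₁ - w) / x₁ := div_pos (sub_pos.2 hw) hx0
    positivity
  have hABint : Integrable fun w => A w * √(π / B w) ^ (n - 1) := by
    simp_rw [hAB]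
    exact (hH.comp_div hx0.ne').comp_sub_left x₁
  obtain ⟨h1, h2⟩ := integrable_mul_exp_neg_perpSq (n := n) (A := A) (B := B)
    (Measurable.indicator (by fun_prop) measurableSet_Iio) (by fun_prop) hA0
    (fun w hw => div_pos hc (div_pos (sub_pos.2 (mem_Iio.1 (mem_of_indicator_ne_zero
      (s := Iio x₁) hw))) hx0)) hABint
  refine ⟨_, fun y => ?_, h1, ?_⟩
  · rw [Z₂, smul_e₁_apply_zero]
    split_ifs with h
    · have hd : 0 < x₁ - y 0 := by linarith [h.2.2]
      have hu : 0 < (x₁ - y 0) / x₁ := div_pos hd hx0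
      simp only [A, B]
      rw [indicator_of_mem (by exact h.2.2), mul_assoc _ (exp _) (exp _), ← exp_add]
      have hp := perpSq_nonneg y
      -- Only u = (x₁ - y₁)/x₁ is kept in the base; the exponential alone controls t and y'.
      have h3 : (t ^ 2 + (x₁ - y 0) / x₁ + perpSq y) ^ (-(((n : ℝ) + 4) / 2)) ≤
          ((x₁ - y 0) / x₁) ^ (-((n : ℝ) / 2 + 2)) := by
        rw [show ((n : ℝ) + 4) / 2 = n / 2 + 2 by ring]
        refine rpow_le_rpow_of_nonpos hu ?_ (by
          have : (0 : ℝ) ≤ n := n.cast_nonneg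
          linarith)
        have : 0 < t ^ 2 := by positivity
        linarith
      have h4 : -(c * ((t ^ 2 + perpSq y) * x₁ / (x₁ - y 0))) =
          -(c * t ^ 2 / ((x₁ - y 0) / x₁)) + -(c / ((x₁ - y 0) / x₁) * perpSq y) := by
        field_simp
        ring
      rw [h4]
      gcongr
    · exact mul_nonneg (hA0 _) (exp_pos _).le
  · rw [h2]
    simp_rw [hAB]
    rw [integral_sub_left_eq_self (fun v : ℝ => H (v / x₁)), Measure.integral_comp_div, hHval,
      abs_of_pos hx0, smul_eq_mul]
    calc _ = Gamma (3 / 2) * c ^ (-(3 / 2) : ℝ) * √(π / c) ^ (n - 1) * (t ^ 2)⁻¹ * x₁⁻¹ := by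
          field_simp
      _ ≤ Gamma (3 / 2) * c ^ (-(3 / 2) : ℝ) * √(π / c) ^ (n - 1) * (t ^ 2)⁻¹ *
          (2 * (1 + x₁)⁻¹) := by
          gcongr
          exact inv_le_two_mul_inv_one_add hx1
      _ = _ := by ring

end Majorants

end OUPoisson
-- The main theorem.
open OUPoisson MeasureTheory in
theorem theorem1p4 (n : ℕ) [NeZero n] :
    ∃ c : ℝ, 0 < c ∧ ∃ C : ℝ, 0 < C ∧
      ∀ t : ℝ, 0 < t → ∀ x₁ : ℝ, 0 ≤ x₁ →
        ∀ x : EuclideanSpace ℝ (Fin n), x = x₁ • e₁ n →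
          (∀ y : EuclideanSpace ℝ (Fin n),
            IntegrableOn (poissonIntegrand t x y) (Set.Ioi 0) ∧
            LineDifferentiableAt ℝ (fun z => OUPoisson.poissonKernel t z y) x (e₁ n) ∧
            |dx₁PoissonKernel t x y| ≤
              C * (Z₁ c t x y + Z₂ c t x y + Z₃ c t x y + Z₄ c t x y)) ∧
          Integrable (fun y => dx₁PoissonKernel t x y) ∧
          ∫ y, |dx₁PoissonKernel t x y| ≤ C * ((t ^ 2)⁻¹ * (1 + x₁)⁻¹) := by
  obtain ⟨C₀, hC₀, h₀⟩ := exists_abs_integral_dxIntegrand_le n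
  obtain ⟨K₁, hK₁, k₁⟩ := exists_integrable_Z₁ n (c := 1 / 4000) (by norm_num)
  obtain ⟨K₂, hK₂, k₂⟩ := exists_majorant_Z₂ n (c := 1 / 4000) (by norm_num)
  obtain ⟨K₃, hK₃, k₃⟩ := exists_majorant_Z₃ n (c := 1 / 4000) (by norm_num)
  obtain ⟨K₄, hK₄, k₄⟩ := exists_majorant_Z₄ n (c := 1 / 4000) (by norm_num)
  set κ : ℝ := 1 / (2 * Real.pi ^ (((n : ℝ) + 1) / 2)) with hκ
  have hκ0 : 0 < κ := by positivity
  -- The rate 1/4000 is the one left in the factor e^{-ct(1+x)} of the near majorant. In the last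
  -- factor of C, the 1 serves the pointwise bound and the Kᵢ the integral bound.
  refine ⟨1 / 4000, by norm_num, κ * C₀ * (1 + K₁ + K₂ + K₃ + K₄), by positivity, ?_⟩
  rintro t ht x₁ hx _ rfl
  have hbound : ∀ y : EuclideanSpace ℝ (Fin n), |dx₁PoissonKernel t (x₁ • e₁ n) y| ≤
      κ * C₀ * (Z₁ (1 / 4000) t (x₁ • e₁ n) y + Z₂ (1 / 4000) t (x₁ • e₁ n) y +
        Z₃ (1 / 4000) t (x₁ • e₁ n) y + Z₄ (1 / 4000) t (x₁ • e₁ n) y) := by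
    intro y
    rw [dx₁PoissonKernel_eq ht, abs_mul, ← hκ, abs_of_pos hκ0, mul_assoc]
    exact mul_le_mul_of_nonneg_left (h₀ t x₁ ht hx y) hκ0.le
  obtain ⟨i₁, I₁⟩ := k₁ t x₁ ht hx
  obtain ⟨M₂, m₂, i₂, I₂⟩ := k₂ t x₁ ht hx
  obtain ⟨M₃, m₃, i₃, I₃⟩ := k₃ t x₁ ht hx
  obtain ⟨M₄, m₄, i₄, I₄⟩ := k₄ t x₁ ht hx
  have hmaj : ∀ y : EuclideanSpace ℝ (Fin n), ‖dx₁PoissonKernel t (x₁ • e₁ n) y‖ ≤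
      κ * C₀ * (Z₁ (1 / 4000) t (x₁ • e₁ n) y + M₂ y + M₃ y + M₄ y) := by
    intro y
    refine (hbound y).trans ?_
    have := m₂ y
    have := m₃ y
    have := m₄ y
    gcongr
  have i₁₂ := i₁.add i₂
  have i₁₂₃ := i₁₂.add i₃
  have hint := (i₁₂₃.add i₄).const_mul (κ * C₀)
  have hdx : Integrable fun y => dx₁PoissonKernel t (x₁ • e₁ n) y :=
    hint.mono' (stronglyMeasurable_dx₁PoissonKernel ht x₁).aestronglyMeasurable
      (Filter.Eventually.of_forall hmaj)
  refine ⟨fun y => ⟨integrableOn_poissonIntegrand ht x₁ y,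
    (hasLineDerivAt_poissonKernel ht x₁ y).lineDifferentiableAt, (hbound y).trans ?_⟩, hdx, ?_⟩
  · have h₁ := Z₁_nonneg (c := 1 / 4000) ht (x₁ • e₁ n) y
    have h₂ := Z₂_nonneg (c := 1 / 4000) ht (x₁ • e₁ n) y
    have h₃ := Z₃_nonneg (c := 1 / 4000) ht (x₁ • e₁ n) y
    have h₄ := Z₄_nonneg (c := 1 / 4000) ht (x₁ • e₁ n) y
    exact mul_le_mul_of_nonneg_right (le_mul_of_one_le_right (by positivity) (by linarith))
      (by positivity)
  · have hR : 0 ≤ (t ^ 2)⁻¹ * (1 + x₁)⁻¹ := by positivity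
    calc ∫ y, |dx₁PoissonKernel t (x₁ • e₁ n) y|
        ≤ ∫ y, κ * C₀ * (Z₁ (1 / 4000) t (x₁ • e₁ n) y + M₂ y + M₃ y + M₄ y) :=
          integral_mono hdx.abs hint hmaj
      _ = κ * C₀ * ((∫ y, Z₁ (1 / 4000) t (x₁ • e₁ n) y) + (∫ y, M₂ y) + (∫ y, M₃ y) +
          ∫ y, M₄ y) := by
          rw [integral_const_mul]
          congr 1
          refine (integral_add i₁₂₃ i₄).trans (congrArg (· + _) ?_)
          refine (integral_add i₁₂ i₃).trans (congrArg (· + _) ?_)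
          exact integral_add i₁ i₂
      _ ≤ κ * C₀ * ((1 + K₁ + K₂ + K₃ + K₄) * ((t ^ 2)⁻¹ * (1 + x₁)⁻¹)) := by
          gcongr
          linarith
      _ = _ := by ring
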